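/- Let $K$ be a nonzero commutative ring, $\mathbb N=\{1,2,3,\dots\}$, $[n]=\{1,\dots,n\}$, and let $a>b\ge 1$ be coprime integers. Let $K[Y]=K[y_{ij}\mid i,j\in\mathbb N,\ i\ne j]$, $K[X]=K[x_i\mid i\in\mathbb N]$, and let \[\pi:K[Y]\to K[X],\qquad y_{ij}\mapsto x_i^a x_j^b .\] The group $S_\infty$ of all bijections $\sigma:\mathbb N\to\mathbb N$ acts on $K[Y]$ by $\sigma(y_{ij})=y_{\sigma(i)\sigma(j)}$. A set $M\subseteq K[Y]$ is called an equivariant Markov basis of $\ker(\pi)$ if the $S_\infty$-orbits of its elements generate the ideal $\ker(\pi)$. The $n$-th truncation of a set of polynomials consists of its elements that involve only variables $y_{ij}$ with $i,j\in[n]$. The width of a set $M\subseteq K[Y]$ is the least $n$ such that every element of $M$ lies in the $S_\infty$-orbit of an element of the $n$-th truncation of $M$; the width of an ideal $I\subseteq K[Y]$ is the least $n$ such that the $S_\infty$-orbits of the elements of the $n$-th truncation of $I$ generate $I$ (in both cases $\infty$ if there is no such $n$). Then the following binomials form an equivariant Markov basis of $\ker(\pi)$: (i) $y_{12}y_{34}-y_{14}y_{32}$;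 (ii) $y_{12}y_{23}y_{31}-y_{21}y_{32}y_{13}$; (iii) for each $0\le n\le a-b$ and all finitely supported families $(c_{1j})_{j\ge3}$, $(c_{2j})_{j\ge 3}$ of nonnegative integers with $\sum_{j\ge3}c_{1j}=a-b-n$ and $\sum_{j\ge3}c_{2j}=n$, \[y_{12}^{b+n}\prod_{j\ge3}y_{j2}^{c_{1j}}y_{2j}^{c_{2j}}-y_{21}^{b+n}\prod_{j\ge3}y_{j1}^{c_{1j}}y_{1j}^{c_{2j}};\] (iv) for each $1\le n\le b$, \[y_{12}^{b-n}y_{13}^{n}y_{32}^{a-b+n}-y_{21}^{b-n}y_{23}^{n}y_{31}^{a-b+n}.\] The maximum of the degrees of these binomials is $\max(a+b,\,2a-b)$. Moreover the width of the ideal $\ker(\pi)$ is \[\max(4,\,a-b+2),\] this is also the width of the set of binomials (i)--(iv), and it is the minimum of the widths of all equivariant Markov bases of $\ker(\pi)$. Finally, if $b\ge2$, then exactly two monomials of $K[Y]$ are mapped by $\pi$ to $x_1^{ab}x_2^{ab}x_3^a x_4^a\cdots x_{a-b+2}^a$, namely $y_{12}^{b}\prod_{j=3}^{a-b+2}y_{j2}$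 and $y_{21}^{b}\prod_{j=3}^{a-b+2}y_{j1}$; their difference is a binomial of type (iii) with $n=0$. -/

import Mathlib

namespace EquivariantMarkov

open MvPolynomial

/-- Indices of the variables `y_{ij}`: ordered pairs of distinct natural numbers.
The index set is `{0, 1, 2, …}`, so the indices `1, 2, 3, …` of the informal text
are `0, 1, 2, …` here and `[n]` is `{0, …, n - 1}`. -/
abbrev YIdx : Type := {p : ℕ × ℕ // p.1 ≠ p.2}

/-- The action of a permutation of `ℕ` on pairs, `(i, j) ↦ (σ i, σ j)`. -/
def permPair (σ : Equiv.Perm ℕ) (p : YIdx) : YIdx :=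
  ⟨(σ p.1.1, σ p.1.2), σ.injective.ne p.2⟩

variable (K : Type*) [CommRing K]

/-- The variable `y_{ij}`, `i ≠ j`. -/
noncomputable def y (i j : ℕ) (h : i ≠ j) : MvPolynomial YIdx K := X ⟨(i, j), h⟩

/-- The monomial map `π : K[Y] → K[X]`, `y_{ij} ↦ x_i ^ a * x_j ^ b`. -/
noncomputable def toricMap (a b : ℕ) : MvPolynomial YIdx K →ₐ[K] MvPolynomial ℕ K :=
  aeval fun p : YIdx => (X p.1.1 ^ a * X p.1.2 ^ b : MvPolynomial ℕ K)

/-- The toric ideal `ker π`. -/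
noncomputable def toricIdeal (a b : ℕ) : Ideal (MvPolynomial YIdx K) :=
  RingHom.ker (toricMap K a b)

variable {K}

/-- The union of the orbits of the elements of `M` under all permutations of `ℕ`,
acting by `σ y_{ij} = y_{σ(i) σ(j)}`. -/
def orbits (M : Set (MvPolynomial YIdx K)) : Set (MvPolynomial YIdx K) :=
  {g | ∃ σ : Equiv.Perm ℕ, ∃ f ∈ M, g = rename (permPair σ) f}

/-- The `n`-th truncation of a set of polynomials: its elements that only involve
variables `y_{ij}` with `i, j ∈ [n]`. -/
def truncation (n : ℕ) (M : Set (MvPolynomial YIdx K)) : Set (MvPolynomial YIdx K) :=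
  {f | f ∈ M ∧ f ∈ supported K {p : YIdx | p.1.1 < n ∧ p.1.2 < n}}

/-- The width of an ideal: the least `n` such that its `n`-th truncation generates it
up to symmetry (infinite if there is no such `n`). -/
noncomputable def idealWidth (I : Ideal (MvPolynomial YIdx K)) : ℕ∞ :=
  sInf {w : ℕ∞ | ∃ n : ℕ,
    Ideal.span (orbits (truncation n (I : Set (MvPolynomial YIdx K)))) = I ∧ w = n}

/-- The width of a set of polynomials: the least `n` such that every element lies in the
orbit of an element of its `n`-th truncation (infinite if there is no such `n`). -/
noncomputable def setWidth (M : Set (MvPolynomial YIdx K)) : ℕ∞ :=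
  sInf {w : ℕ∞ | ∃ n : ℕ, M ⊆ orbits (truncation n M) ∧ w = n}

/-- `M` is an equivariant Markov basis of `ker π`: the orbits of its elements generate the
ideal `ker π`. -/
def IsEquivariantMarkovBasis (a b : ℕ) (M : Set (MvPolynomial YIdx K)) : Prop :=
  Ideal.span (orbits M) = toricIdeal K a b

variable (K)

/-- The basic quadric `y₁₂ y₃₄ - y₁₄ y₃₂` (indices in the code are one smaller). -/
noncomputable def basicQuadric : MvPolynomial YIdx K :=
  y K 0 1 (by decide) * y K 2 3 (by decide) - y K 0 3 (by decide) * y K 2 1 (by decide)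

/-- The 3-cycle cubic `y₁₂ y₂₃ y₃₁ - y₂₁ y₃₂ y₁₃` (indices in the code are one smaller). -/
noncomputable def threeCycleCubic : MvPolynomial YIdx K :=
  y K 0 1 (by decide) * y K 1 2 (by decide) * y K 2 0 (by decide)
    - y K 1 0 (by decide) * y K 2 1 (by decide) * y K 0 2 (by decide)

/-- The binomial
`y₁₂ ^ (b+n) ∏_{j ≥ 3} y_{j2} ^ c_{1j} y_{2j} ^ c_{2j}
  - y₂₁ ^ (b+n) ∏_{j ≥ 3} y_{j1} ^ c_{1j} y_{1j} ^ c_{2j}`.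
Here `c₁ k` and `c₂ k` stand for `c_{1j}` and `c_{2j}` with `j = k + 3`, and that `j` is
the index `k + 2` in the code. -/
noncomputable def familyThree (b n : ℕ) (c₁ c₂ : ℕ →₀ ℕ) : MvPolynomial YIdx K :=
  y K 0 1 (by decide) ^ (b + n)
      * ((c₁.prod fun k m => y K (k + 2) 1 (by omega) ^ m)
        * (c₂.prod fun k m => y K 1 (k + 2) (by omega) ^ m))
    - y K 1 0 (by decide) ^ (b + n)
      * ((c₁.prod fun k m => y K (k + 2) 0 (by omega) ^ m)
        * (c₂.prod fun k m => y K 0 (k + 2) (by omega) ^ m))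

/-- The binomial
`y₁₂ ^ (b-n) y₁₃ ^ n y₃₂ ^ (a-b+n) - y₂₁ ^ (b-n) y₂₃ ^ n y₃₁ ^ (a-b+n)`
(indices in the code are one smaller). -/
noncomputable def familyFour (a b n : ℕ) : MvPolynomial YIdx K :=
  y K 0 1 (by decide) ^ (b - n) * y K 0 2 (by decide) ^ n * y K 2 1 (by decide) ^ (a - b + n)
    - y K 1 0 (by decide) ^ (b - n) * y K 1 2 (by decide) ^ n * y K 2 0 (by decide) ^ (a - b + n)

/-- The four families together (used for `b < a`, where the subtractions are genuine). -/
def markovFamily (a b : ℕ) : Set (MvPolynomial YIdx K) :=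
  {f | f = basicQuadric K
    ∨ f = threeCycleCubic K
    ∨ (∃ (n : ℕ) (c₁ c₂ : ℕ →₀ ℕ), n ≤ a - b ∧ (c₁.sum fun _ m => m) = a - b - n ∧
        (c₂.sum fun _ m => m) = n ∧ f = familyThree K b n c₁ c₂)
    ∨ (∃ n : ℕ, 1 ≤ n ∧ n ≤ b ∧ f = familyFour K a b n)}

/-- The fiber of `π` over `q`: the monomials of `K[Y]` that `π` maps to `q`. -/
def fiber (a b : ℕ) (q : MvPolynomial ℕ K) : Set (MvPolynomial YIdx K) :=
  {f | (∃ m : YIdx →₀ ℕ, f = monomial m 1) ∧ toricMap K a b f = q}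

/-- The monomial `y₁₂ ^ b ∏_{j=3}^{a-b+2} y_{j2}` (indices in the code are one smaller). -/
noncomputable def starLeft (a b : ℕ) : MvPolynomial YIdx K :=
  y K 0 1 (by decide) ^ b * ∏ k ∈ Finset.range (a - b), y K (k + 2) 1 (by omega)

/-- The monomial `y₂₁ ^ b ∏_{j=3}^{a-b+2} y_{j1}` (indices in the code are one smaller). -/
noncomputable def starRight (a b : ℕ) : MvPolynomial YIdx K :=
  y K 1 0 (by decide) ^ b * ∏ k ∈ Finset.range (a - b), y K (k + 2) 0 (by omega)

end EquivariantMarkov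

namespace EquivariantMarkov

open MvPolynomial

/-! A monomial of `K[Y]` is a loopless directed multigraph `G` on the vertex set `ℕ`, and `π`
records the number `a * outDeg i G + b * inDeg i G` at each vertex `i`. The kernel is generated by
differences of monomials with equal records (`toricIdeal_le`), so generation by the four families
means that any two such multigraphs are congruent modulo the families.

Suppose `G` and `H` have the same record. By coprimality their out-degrees at a vertex differ by a
multiple `b * d`, compensated by a difference `a * d` of in-degrees (`le_sub_of_expo_eq`). If all
out-degrees agree, so do all in-degrees, and quadrics and 3-cycle cubics connect `G` to `H`
(`conn_of_degrees_eq`). Otherwise some `i` has too large and some `j` too small an out-degree in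
`G`. Then `i` has out-degree at least `b`, `j` has in-degree at least `a`, and at least `a - b`
edges avoid `i`. After some quadric moves `G` contains one side of a binomial of type (iii) or (iv)
placed on `i`, `j` (`exchangeable_of_degrees`). Replacing that side by its mirror image moves `b`
units of out-degree from `i` to `j`, and induction on the total surplus of out-degree finishes
(`conn_of_expo_eq`).

For the lower bound on the width, take a monomial with a non-singleton fiber all of whose proper
divisors have singleton fibers. Its coefficient vanishes in every multiple of a kernel element in
which it does not itself occur. Hence generators must involve it, up to symmetry, and so need as
many indices as it has vertices (`exists_perm_of_span_truncation`). The quadric gives 4 and the star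
with `a - b + 1` sources gives `a - b + 2`. Counting the vertices of the four families shows that
these bounds are attained. -/

/-! ### Counting edges of a multigraph -/

/-- The number of edges of the multigraph `G` that satisfy `P`. -/
noncomputable def count (P : YIdx → Prop) [DecidablePred P] : (YIdx →₀ ℕ) →+ ℕ :=
  Finsupp.weight fun p => if P p then 1 else 0

/-- The number of edges that leave `i`. -/
noncomputable abbrev outDeg (i : ℕ) : (YIdx →₀ ℕ) →+ ℕ := count fun p => p.1.1 = i

/-- The number of edges that enter `i`. -/
noncomputable abbrev inDeg (i : ℕ) : (YIdx →₀ ℕ) →+ ℕ := count fun p => p.1.2 = i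

lemma count_single (P : YIdx → Prop) [DecidablePred P] (p : YIdx) (n : ℕ) :
    count P (Finsupp.single p n) = if P p then n else 0 := by
  simp [count, Finsupp.weight_single]

lemma count_union (P Q R : YIdx → Prop) [DecidablePred P] [DecidablePred Q] [DecidablePred R]
    (h : ∀ p, R p ↔ P p ∨ Q p) (hd : ∀ p, P p → ¬ Q p) (G : YIdx →₀ ℕ) :
    count R G = count P G + count Q G := by
  induction G using Finsupp.induction_linear with
  | zero => simp
  | add f g hf hg => simp only [map_add, hf, hg]; ring
  | single p n =>
    have := h p
    have := hd p
    simp only [count_single]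
    split_ifs <;> simp_all

lemma count_eq_degree_filter (P : YIdx → Prop) [DecidablePred P] (G : YIdx →₀ ℕ) :
    count P G = (G.filter P).degree := by
  induction G using Finsupp.induction_linear with
  | zero => simp [Finsupp.filter_zero]
  | add f g hf hg => simp only [map_add, hf, hg, Finsupp.filter_add]
  | single p n =>
    rw [count_single]
    split_ifs with h
    · rw [Finsupp.filter_single_of_pos _ h, Finsupp.degree_single]
    · rw [Finsupp.filter_single_of_neg _ h, map_zero]

lemma count_mono (P : YIdx → Prop) [DecidablePred P] {G H : YIdx →₀ ℕ} (h : G ≤ H) :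
    count P G ≤ count P H := by
  obtain ⟨R, rfl⟩ := exists_add_of_le h
  simp

lemma exists_le_of_le_count (P : YIdx → Prop) [DecidablePred P] {G : YIdx →₀ ℕ} {n : ℕ}
    (h : n ≤ count P G) : ∃ A ≤ G, A.degree = n ∧ ∀ p ∈ A.support, P p := by
  rw [count_eq_degree_filter] at h
  obtain ⟨A, hA, hn⟩ := Finsupp.exists_le_degree_eq _ n h
  refine ⟨A, hA.trans fun p => ?_, hn, fun p hp => ?_⟩
  · rw [Finsupp.filter_apply]; split_ifs <;> simp
  · by_contra hP
    have := hA p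
    rw [Finsupp.filter_apply_neg _ _ hP] at this
    simp at hp; omega

lemma exists_of_count_pos (P : YIdx → Prop) [DecidablePred P] {G : YIdx →₀ ℕ}
    (h : 0 < count P G) : ∃ p, P p ∧ 0 < G p := by
  obtain ⟨A, hA, hn, hp⟩ := exists_le_of_le_count P (n := 1) h
  have : A ≠ 0 := by rintro rfl; simp at hn
  obtain ⟨p, hpA⟩ := Finsupp.support_nonempty_iff.2 this
  exact ⟨p, hp p hpA, lt_of_lt_of_le (Nat.pos_of_ne_zero (by simpa using hpA)) (hA p)⟩

lemma le_count (P : YIdx → Prop) [DecidablePred P] {G : YIdx →₀ ℕ} {p : YIdx} (h : P p) :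
    G p ≤ count P G := by
  have : Finsupp.single p (G p) ≤ G := by simp
  simpa [count_single, h] using count_mono P this

lemma count_eq_degree (P : YIdx → Prop) [DecidablePred P] {G : YIdx →₀ ℕ}
    (h : ∀ p ∈ G.support, P p) : count P G = G.degree := by
  rw [count_eq_degree_filter, (Finsupp.filter_eq_self_iff _ _).2]
  simpa using h

lemma count_eq_zero (P : YIdx → Prop) [DecidablePred P] {G : YIdx →₀ ℕ}
    (h : ∀ p ∈ G.support, ¬ P p) : count P G = 0 := by
  by_contra h0
  obtain ⟨p, hp, hG⟩ := exists_of_count_pos P (Nat.pos_of_ne_zero h0)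
  exact h p (by simpa using hG.ne') hp

lemma mapDomain_fst_apply (G : YIdx →₀ ℕ) (i : ℕ) :
    G.mapDomain (fun p : YIdx => p.1.1) i = outDeg i G := by
  induction G using Finsupp.induction_linear with
  | zero => simp
  | add f g hf hg => simp only [map_add, Finsupp.mapDomain_add, Finsupp.add_apply, hf, hg]
  | single p n => simp [count_single, Finsupp.mapDomain_single, Finsupp.single_apply]

lemma mapDomain_snd_apply (G : YIdx →₀ ℕ) (i : ℕ) :
    G.mapDomain (fun p : YIdx => p.1.2) i = inDeg i G := by
  induction G using Finsupp.induction_linear with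
  | zero => simp
  | add f g hf hg => simp only [map_add, Finsupp.mapDomain_add, Finsupp.add_apply, hf, hg]
  | single p n => simp [count_single, Finsupp.mapDomain_single, Finsupp.single_apply]

/-! ### The exponent vector of the image of a monomial -/

/-- The exponent vector of the image of a monomial under `π`. -/
noncomputable def expo (a b : ℕ) (G : YIdx →₀ ℕ) : ℕ →₀ ℕ :=
  a • G.mapDomain (fun p : YIdx => p.1.1) + b • G.mapDomain (fun p : YIdx => p.1.2)

lemma expo_apply (a b : ℕ) (G : YIdx →₀ ℕ) (i : ℕ) :
    expo a b G i = a * outDeg i G + b * inDeg i G := by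
  simp [expo, mapDomain_fst_apply, mapDomain_snd_apply]

lemma expo_add (a b : ℕ) (G H : YIdx →₀ ℕ) : expo a b (G + H) = expo a b G + expo a b H := by
  ext i
  simp only [expo_apply, Finsupp.add_apply, map_add]
  ring

lemma expo_eq_iff {a b : ℕ} {G H : YIdx →₀ ℕ} : expo a b G = expo a b H ↔
    ∀ i, a * outDeg i G + b * inDeg i G = a * outDeg i H + b * inDeg i H := by
  simp only [Finsupp.ext_iff, expo_apply]

lemma degree_expo (a b : ℕ) (G : YIdx →₀ ℕ) : (expo a b G).degree = (a + b) * G.degree := by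
  simp only [expo, map_add, map_nsmul, Finsupp.degree_mapDomain, smul_eq_mul]
  ring

lemma toricMap_monomial (K : Type*) [CommRing K] (a b : ℕ) (G : YIdx →₀ ℕ) (r : K) :
    toricMap K a b (monomial G r) = monomial (expo a b G) r := by
  induction G using Finsupp.induction_linear generalizing r with
  | zero =>
    have : expo a b 0 = 0 := by ext; simp [expo_apply]
    rw [this, ← C_apply, ← C_apply, toricMap, aeval_C]; rfl
  | add f g hf hg =>
    rw [expo_add, ← mul_one r, ← monomial_mul, ← monomial_mul, map_mul, hf, hg]
  | single p n =>
    have : expo a b (Finsupp.single p n)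
        = n • (Finsupp.single p.1.1 a + Finsupp.single p.1.2 b) := by
      simp [expo, Finsupp.mapDomain_single, mul_comm]
    rw [toricMap, aeval_monomial, Finsupp.prod_single_index (by simp), this,
      X_pow_eq_monomial, X_pow_eq_monomial, monomial_mul, monomial_pow, algebraMap_eq,
      C_mul_monomial]
    simp

/-- No other monomial of `f` is sent to the same monomial of `K[X]`, so nothing can be added to or
cancel the coefficient of `e`. Applied to kernel elements, it makes that coefficient zero. -/
lemma coeff_toricMap_of_fiber {K : Type*} [CommRing K] {a b : ℕ} {e : YIdx →₀ ℕ}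
    (he : ∀ e', expo a b e' = expo a b e → e' = e) (f : MvPolynomial YIdx K) :
    coeff (expo a b e) (toricMap K a b f) = coeff e f := by
  induction f using MvPolynomial.induction_on' with
  | monomial u r =>
    classical
    rw [toricMap_monomial, coeff_monomial, coeff_monomial]
    by_cases h : u = e
    · simp [h]
    · rw [if_neg h, if_neg fun h' => h (he u h')]
  | add p q hp hq => rw [map_add, coeff_add, coeff_add, hp, hq]

lemma mem_toricIdeal {K : Type*} [CommRing K] {a b : ℕ} {f : MvPolynomial YIdx K} :
    f ∈ toricIdeal K a b ↔ toricMap K a b f = 0 := RingHom.mem_ker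

lemma monomial_sub_mem_toricIdeal {K : Type*} [CommRing K] [Nontrivial K] {a b : ℕ}
    {u v : YIdx →₀ ℕ} :
    monomial u (1 : K) - monomial v 1 ∈ toricIdeal K a b ↔ expo a b u = expo a b v := by
  rw [mem_toricIdeal, map_sub, toricMap_monomial, toricMap_monomial, sub_eq_zero]
  exact ⟨fun h => monomial_left_injective one_ne_zero h, fun h => by rw [h]⟩

/-- `ker π` is contained in every ideal that contains its pure binomials. -/
lemma toricIdeal_le {K : Type*} [CommRing K] {a b : ℕ} (J : Ideal (MvPolynomial YIdx K))
    (hJ : ∀ u v, expo a b u = expo a b v → monomial u (1 : K) - monomial v 1 ∈ J) :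
    toricIdeal K a b ≤ J := by
  -- `s` picks one monomial in each fiber and `L` is its linear extension. Modulo `J` every `f`
  -- equals `L` of its image, and this is `0` on the kernel.
  set s := Function.invFun (expo a b) with hs
  have hs' (u) : expo a b (s (expo a b u)) = expo a b u :=
    Function.invFun_eq (f := expo a b) ⟨u, rfl⟩
  let L : MvPolynomial ℕ K →ₗ[K] MvPolynomial YIdx K :=
    (basisMonomials ℕ K).constr K fun v => monomial (s v) 1
  have hL (v : ℕ →₀ ℕ) (r : K) : L (monomial v r) = monomial (s v) r := by
    have h1 : monomial v r = r • basisMonomials ℕ K v := by simp [smul_monomial]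
    rw [h1, map_smul, Module.Basis.constr_basis, smul_monomial, smul_eq_mul, mul_one]
  have key (f : MvPolynomial YIdx K) : f - L (toricMap K a b f) ∈ J := by
    induction f using MvPolynomial.induction_on' with
    | monomial u r =>
      rw [toricMap_monomial, hL]
      have := J.mul_mem_left (C r) (hJ u (s (expo a b u)) (hs' u).symm)
      simpa [mul_sub, C_mul_monomial] using this
    | add p q hp hq =>
      rw [map_add, map_add, add_sub_add_comm]
      exact J.add_mem hp hq
  intro f hf
  have := key f
  rwa [mem_toricIdeal.1 hf, map_zero, sub_zero] at this

/-! ### Permutations -/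

lemma rename_toricMap {K : Type*} [CommRing K] (a b : ℕ) (σ : Equiv.Perm ℕ)
    (f : MvPolynomial YIdx K) :
    toricMap K a b (rename (permPair σ) f) = rename σ (toricMap K a b f) := by
  rw [toricMap, aeval_rename, ← AlgHom.comp_apply, comp_aeval]
  congr 2
  funext p
  simp [permPair]

lemma rename_mem_toricIdeal {K : Type*} [CommRing K] {a b : ℕ} (σ : Equiv.Perm ℕ)
    {f : MvPolynomial YIdx K} (hf : f ∈ toricIdeal K a b) :
    rename (permPair σ) f ∈ toricIdeal K a b := by
  rw [mem_toricIdeal] at hf ⊢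
  rw [rename_toricMap, hf, map_zero]

lemma permPair_mul (σ τ : Equiv.Perm ℕ) : permPair (σ * τ) = permPair σ ∘ permPair τ := rfl

lemma permPair_one : permPair 1 = id := rfl

lemma permPair_injective (σ : Equiv.Perm ℕ) : Function.Injective (permPair σ) := by
  rintro ⟨⟨i, j⟩, h⟩ ⟨⟨k, l⟩, h'⟩ he
  simpa [permPair] using he

lemma orbits_mono {K : Type*} [CommRing K] {M N : Set (MvPolynomial YIdx K)} (h : M ⊆ N) :
    orbits M ⊆ orbits N := by
  rintro _ ⟨σ, f, hf, rfl⟩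
  exact ⟨σ, f, h hf, rfl⟩

lemma orbits_orbits {K : Type*} [CommRing K] (M : Set (MvPolynomial YIdx K)) :
    orbits (orbits M) ⊆ orbits M := by
  rintro _ ⟨σ, _, ⟨τ, f, hf, rfl⟩, rfl⟩
  exact ⟨σ * τ, f, hf, by rw [rename_rename, permPair_mul]⟩

lemma subset_orbits {K : Type*} [CommRing K] (M : Set (MvPolynomial YIdx K)) :
    M ⊆ orbits M := fun f hf => ⟨1, f, hf, by rw [permPair_one, rename_id_apply]⟩

lemma span_orbits_le {K : Type*} [CommRing K] {a b : ℕ} {M : Set (MvPolynomial YIdx K)}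
    (h : M ⊆ toricIdeal K a b) : Ideal.span (orbits M) ≤ toricIdeal K a b := by
  rw [Ideal.span_le]
  rintro _ ⟨σ, f, hf, rfl⟩
  exact rename_mem_toricIdeal σ (h hf)

/-- Injective sequences of natural numbers of the same length are in one orbit. -/
lemma exists_perm_apply_eq {n : ℕ} (x y : Fin n → ℕ) (hx : Function.Injective x)
    (hy : Function.Injective y) : ∃ σ : Equiv.Perm ℕ, ∀ i, σ (x i) = y i := by
  have := Equiv.Perm.isMultiplyPretransitive ℕ n
  obtain ⟨g, hg⟩ := MulAction.IsPretransitive.exists_smul_eq (M := Equiv.Perm ℕ)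
    (⟨x, hx⟩ : Fin n ↪ ℕ) ⟨y, hy⟩
  exact ⟨g, fun i => DFunLike.congr_fun hg i⟩


/-! ### Monomials that are congruent modulo the Markov family -/

/-- The ideal generated by the orbits of the four families. -/
noncomputable def markovIdeal (K : Type*) [CommRing K] (a b : ℕ) :
    Ideal (MvPolynomial YIdx K) := Ideal.span (orbits (markovFamily K a b))

/-- Two monomials are congruent modulo the ideal generated by the orbits of the four families. -/
def Conn (K : Type*) [CommRing K] (a b : ℕ) (u v : YIdx →₀ ℕ) : Prop :=
  monomial u (1 : K) - monomial v 1 ∈ markovIdeal K a b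

section
variable {K : Type*} [CommRing K] {a b : ℕ} {u v w u' v' : YIdx →₀ ℕ}

lemma Conn.refl (u : YIdx →₀ ℕ) : Conn K a b u u := by simp [Conn]

lemma Conn.symm (h : Conn K a b u v) : Conn K a b v u := by
  rw [Conn, ← neg_sub]; exact neg_mem h

lemma Conn.trans (h : Conn K a b u v) (h' : Conn K a b v w) : Conn K a b u w := by
  rw [Conn, ← sub_add_sub_cancel]; exact add_mem h h'

lemma Conn.add_right (h : Conn K a b u v) (w : YIdx →₀ ℕ) : Conn K a b (u + w) (v + w) := by
  have := (markovIdeal K a b).mul_mem_right (monomial w 1) h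
  simpa [Conn, sub_mul, monomial_mul] using this

lemma Conn.perm (σ : Equiv.Perm ℕ) {f : MvPolynomial YIdx K} (hf : f ∈ markovFamily K a b)
    (h : f = monomial u 1 - monomial v 1) :
    Conn K a b (u.mapDomain (permPair σ)) (v.mapDomain (permPair σ)) := by
  refine Ideal.subset_span ⟨σ, f, hf, ?_⟩
  rw [h, map_sub, rename_monomial, rename_monomial]

end

/-! ### Exponent vectors of the four families -/

/-- The edge from `i` to `j`, as an exponent vector. -/
noncomputable abbrev edge (i j : ℕ) (h : i ≠ j) : YIdx →₀ ℕ := Finsupp.single ⟨(i, j), h⟩ 1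

section
variable (K : Type*) [CommRing K]

lemma y_eq (i j : ℕ) (h : i ≠ j) : y K i j h = monomial (edge i j h) 1 := rfl

lemma y_pow_eq (i j : ℕ) (h : i ≠ j) (n : ℕ) :
    y K i j h ^ n = monomial (Finsupp.single ⟨(i, j), h⟩ n) 1 := by
  rw [y, X_pow_eq_monomial]

lemma prod_monomial_single (f : ℕ → YIdx) (c : ℕ →₀ ℕ) :
    (c.prod fun k m => monomial (Finsupp.single (f k) m) (1 : K))
      = monomial (c.mapDomain f) 1 := by
  rw [monomial_eq, C_1, one_mul, Finsupp.prod_mapDomain_index (by simp) fun _ _ _ => pow_add _ _ _]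
  simp only [X_pow_eq_monomial]

lemma basicQuadric_eq : basicQuadric K =
    monomial (edge 0 1 (by decide) + edge 2 3 (by decide)) 1
      - monomial (edge 0 3 (by decide) + edge 2 1 (by decide)) 1 := by
  simp only [basicQuadric, y_eq, monomial_mul, mul_one]

lemma threeCycleCubic_eq : threeCycleCubic K =
    monomial (edge 0 1 (by decide) + edge 1 2 (by decide) + edge 2 0 (by decide)) 1
      - monomial (edge 1 0 (by decide) + edge 2 1 (by decide) + edge 0 2 (by decide)) 1 := by
  simp only [threeCycleCubic, y_eq, monomial_mul, mul_one]

/-- The positive part of `familyThree`. -/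
noncomputable def threeExp (b n : ℕ) (c₁ c₂ : ℕ →₀ ℕ) : YIdx →₀ ℕ :=
  Finsupp.single ⟨(0, 1), by decide⟩ (b + n)
    + (c₁.mapDomain (fun k => ⟨(k + 2, 1), by simp⟩)
      + c₂.mapDomain (fun k => ⟨(1, k + 2), by simp⟩))

/-- The positive part of `familyFour`. -/
noncomputable def fourExp (a b n : ℕ) : YIdx →₀ ℕ :=
  Finsupp.single ⟨(0, 1), by decide⟩ (b - n) + Finsupp.single ⟨(0, 2), by decide⟩ n
    + Finsupp.single ⟨(2, 1), by decide⟩ (a - b + n)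

/-- Interchange of the vertices `i` and `j` of a multigraph. -/
noncomputable def swapped (i j : ℕ) (G : YIdx →₀ ℕ) : YIdx →₀ ℕ :=
  G.mapDomain (permPair (Equiv.swap i j))

lemma familyThree_eq (b n : ℕ) (c₁ c₂ : ℕ →₀ ℕ) : familyThree K b n c₁ c₂ =
    monomial (threeExp b n c₁ c₂) 1 - monomial (swapped 0 1 (threeExp b n c₁ c₂)) 1 := by
  have h (k : ℕ) : Equiv.swap 0 1 (k + 2) = k + 2 :=
    Equiv.swap_apply_of_ne_of_ne (by omega) (by omega)
  have h₁ : permPair (Equiv.swap 0 1) ∘ (fun k => (⟨(k + 2, 1), by simp⟩ : YIdx))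
      = fun k => ⟨(k + 2, 0), by simp⟩ := by
    funext k
    simp [permPair, h]
  have h₂ : permPair (Equiv.swap 0 1) ∘ (fun k => (⟨(1, k + 2), by simp⟩ : YIdx))
      = fun k => ⟨(0, k + 2), by simp⟩ := by
    funext k
    simp [permPair, h]
  simp only [familyThree, threeExp, swapped, y, X_pow_eq_monomial,
    Finsupp.mapDomain_add, Finsupp.mapDomain_single, ← Finsupp.mapDomain_comp, h₁, h₂,
    prod_monomial_single, monomial_mul, mul_one]
  rfl

lemma familyFour_eq (a b n : ℕ) : familyFour K a b n =
    monomial (fourExp a b n) 1 - monomial (swapped 0 1 (fourExp a b n)) 1 := by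
  have h : Equiv.swap 0 1 2 = 2 := Equiv.swap_apply_of_ne_of_ne (by omega) (by omega)
  simp only [familyFour, fourExp, swapped, y_pow_eq, Finsupp.mapDomain_add,
    Finsupp.mapDomain_single, monomial_mul, mul_one]
  rfl

end

/-! ### Congruences given by the families at arbitrary vertices -/

section
variable {K : Type*} [CommRing K] {a b : ℕ}

lemma conn_quadric (i j k l : ℕ) (hij : i ≠ j) (hkl : k ≠ l) (hil : i ≠ l) (hkj : k ≠ j)
    (hik : i ≠ k) (hjl : j ≠ l) :
    Conn K a b (edge i j hij + edge k l hkl) (edge i l hil + edge k j hkj) := by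
  obtain ⟨σ, hσ⟩ := exists_perm_apply_eq (n := 4) (fun i => i) ![i, j, k, l]
    Fin.val_injective (by
      intro x z; fin_cases x <;> fin_cases z <;> simp <;> simp_all [eq_comm])
  have h0 : σ 0 = i := hσ 0
  have h1 : σ 1 = j := hσ 1
  have h2 : σ 2 = k := hσ 2
  have h3 : σ 3 = l := hσ 3
  have := Conn.perm (a := a) (b := b) σ (Or.inl rfl) (basicQuadric_eq K)
  simpa [Finsupp.mapDomain_add, Finsupp.mapDomain_single, permPair, h0, h1, h2, h3] using this

lemma conn_cubic (i j k : ℕ) (hij : i ≠ j) (hjk : j ≠ k) (hki : k ≠ i) :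
    Conn K a b (edge i j hij + edge j k hjk + edge k i hki)
      (edge j i hij.symm + edge k j hjk.symm + edge i k hki.symm) := by
  obtain ⟨σ, hσ⟩ := exists_perm_apply_eq (n := 3) (fun i => i) ![i, j, k]
    Fin.val_injective (by
      intro x z; fin_cases x <;> fin_cases z <;> simp <;> simp_all [eq_comm])
  have h0 : σ 0 = i := hσ 0
  have h1 : σ 1 = j := hσ 1
  have h2 : σ 2 = k := hσ 2
  have := Conn.perm (a := a) (b := b) σ (Or.inr (Or.inl rfl)) (threeCycleCubic_eq K)
  simpa [Finsupp.mapDomain_add, Finsupp.mapDomain_single, permPair, h0, h1, h2] using this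

lemma permPair_swap_comm (σ : Equiv.Perm ℕ) (i j : ℕ) :
    permPair σ ∘ permPair (Equiv.swap i j)
      = permPair (Equiv.swap (σ i) (σ j)) ∘ permPair σ := by
  rw [← permPair_mul, ← permPair_mul, Equiv.mul_swap_eq_swap_mul]

lemma mapDomain_swapped (σ : Equiv.Perm ℕ) (i j : ℕ) (G : YIdx →₀ ℕ) :
    (swapped i j G).mapDomain (permPair σ)
      = swapped (σ i) (σ j) (G.mapDomain (permPair σ)) := by
  rw [swapped, swapped, ← Finsupp.mapDomain_comp, permPair_swap_comm, Finsupp.mapDomain_comp]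

lemma conn_four (i j k : ℕ) (hij : i ≠ j) (hik : i ≠ k) (hkj : k ≠ j) {n : ℕ} (hn : 1 ≤ n)
    (hnb : n ≤ b) {U : YIdx →₀ ℕ} (hU : U = Finsupp.single ⟨(i, j), hij⟩ (b - n)
      + Finsupp.single ⟨(i, k), hik⟩ n + Finsupp.single ⟨(k, j), hkj⟩ (a - b + n)) :
    Conn K a b U (swapped i j U) := by
  obtain ⟨σ, hσ⟩ := exists_perm_apply_eq (n := 3) (fun i => i) ![i, j, k]
    Fin.val_injective (by
      clear hU
      intro x z; fin_cases x <;> fin_cases z <;> simp <;> simp_all [eq_comm])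
  have h0 : σ 0 = i := hσ 0
  have h1 : σ 1 = j := hσ 1
  have h2 : σ 2 = k := hσ 2
  have := Conn.perm σ (Or.inr (Or.inr (Or.inr ⟨n, hn, hnb, rfl⟩))) (familyFour_eq K a b n)
  rw [mapDomain_swapped, h0, h1] at this
  have hU' : (fourExp a b n).mapDomain (permPair σ) = U := by
    simp only [hU, fourExp, Finsupp.mapDomain_add, Finsupp.mapDomain_single, permPair, h0, h1, h2]
  rwa [hU'] at this

lemma conn_three (i j : ℕ) (hij : i ≠ j) {n : ℕ} (hn : n ≤ a - b) {A B U : YIdx →₀ ℕ}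
    (hA : ∀ p ∈ A.support, p.1.2 = j ∧ p.1.1 ≠ i) (hB : ∀ p ∈ B.support, p.1.1 = j ∧ p.1.2 ≠ i)
    (hAn : A.degree = a - b - n) (hBn : B.degree = n)
    (hU : U = Finsupp.single ⟨(i, j), hij⟩ (b + n) + (A + B)) :
    Conn K a b U (swapped i j U) := by
  obtain ⟨σ, hσ⟩ := exists_perm_apply_eq (n := 2) (fun i => i) ![i, j]
    Fin.val_injective (by
      intro x z; fin_cases x <;> fin_cases z <;> simp <;> simp_all [eq_comm])
  have h0 : σ 0 = i := hσ 0
  have h1 : σ 1 = j := hσ 1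
  have hsurj (k : ℕ) (hi : k ≠ i) (hj : k ≠ j) : ∃ l, σ (l + 2) = k := by
    obtain ⟨m, rfl⟩ := σ.surjective k
    match m with
    | 0 => exact absurd h0 hi
    | 1 => exact absurd h1 hj
    | l + 2 => exact ⟨l, rfl⟩
  -- Every edge of `A` enters `j` from a vertex of the form `σ (k + 2)`, so `A` is the `σ`-image of
  -- edges from `k + 2` to `1`. The same holds for `B` with edges reversed.
  obtain ⟨c₁, rfl⟩ : ∃ c₁ : ℕ →₀ ℕ, A = c₁.mapDomain
      (permPair σ ∘ fun k => (⟨(k + 2, 1), by simp⟩ : YIdx)) := by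
    have hinj : Function.Injective (permPair σ ∘ fun k => (⟨(k + 2, 1), by simp⟩ : YIdx)) :=
      (permPair_injective σ).comp fun k l h => by simpa using h
    refine ⟨A.comapDomain _ hinj.injOn, (Finsupp.mapDomain_comapDomain _ hinj _ ?_).symm⟩
    intro p hp
    obtain ⟨⟨k, l⟩, hkl⟩ := p
    obtain ⟨rfl, hk⟩ := hA _ hp
    obtain ⟨k, rfl⟩ := hsurj k hk hkl
    exact ⟨k, by simp [permPair, h1]⟩
  obtain ⟨c₂, rfl⟩ : ∃ c₂ : ℕ →₀ ℕ, B = c₂.mapDomain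
      (permPair σ ∘ fun k => (⟨(1, k + 2), by simp⟩ : YIdx)) := by
    have hinj : Function.Injective (permPair σ ∘ fun k => (⟨(1, k + 2), by simp⟩ : YIdx)) :=
      (permPair_injective σ).comp fun k l h => by simpa using h
    refine ⟨B.comapDomain _ hinj.injOn, (Finsupp.mapDomain_comapDomain _ hinj _ ?_).symm⟩
    intro p hp
    obtain ⟨⟨k, l⟩, hkl⟩ := p
    obtain ⟨rfl, hk⟩ := hB _ hp
    obtain ⟨l, rfl⟩ := hsurj l hk hkl.symm
    exact ⟨l, by simp [permPair, h1]⟩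
  rw [Finsupp.degree_mapDomain, Finsupp.degree_apply] at hAn hBn
  have := Conn.perm σ (Or.inr (Or.inr (Or.inl ⟨n, c₁, c₂, hn, hAn, hBn, rfl⟩)))
    (familyThree_eq K b n c₁ c₂)
  rw [mapDomain_swapped, h0, h1] at this
  have hU' : (threeExp b n c₁ c₂).mapDomain (permPair σ) = U := by
    simp [hU, threeExp, Finsupp.mapDomain_add, Finsupp.mapDomain_single, permPair, h0, h1,
      Finsupp.mapDomain_comp]
  rwa [hU'] at this

end


/-! ### Moves that preserve all degrees -/

lemma degree_eq_of_outDeg_eq {G H : YIdx →₀ ℕ} (h : ∀ i, outDeg i G = outDeg i H) :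
    G.degree = H.degree := by
  rw [← Finsupp.degree_mapDomain (fun p : YIdx => p.1.1) G,
    ← Finsupp.degree_mapDomain (fun p : YIdx => p.1.1) H]
  congr 1
  ext i
  rw [mapDomain_fst_apply, mapDomain_fst_apply, h]

/-- The number of edges of `G` that are not incident to `i`. -/
noncomputable abbrev avoid (i : ℕ) : (YIdx →₀ ℕ) →+ ℕ := count fun p => p.1.1 ≠ i ∧ p.1.2 ≠ i

/-- There are no loops, so no edge is counted in both degrees at `i`. Thus the out- and in-degrees
determine how many edges avoid a vertex. -/
lemma degree_eq_avoid_add (i : ℕ) (G : YIdx →₀ ℕ) :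
    G.degree = avoid i G + (outDeg i G + inDeg i G) := by
  have h1 := count_union (fun p => p.1.1 = i) (fun p => p.1.2 = i)
    (fun p => p.1.1 = i ∨ p.1.2 = i) (fun p => Iff.rfl)
    (fun p h h' => p.2 (h.trans h'.symm)) G
  have h2 := count_union (fun p => p.1.1 ≠ i ∧ p.1.2 ≠ i) (fun p => p.1.1 = i ∨ p.1.2 = i)
    (fun _ => True) (fun p => by tauto) (fun p => by tauto) G
  rw [← count_eq_degree (fun _ => True) fun _ _ => trivial, h2, h1]

/-- `G` and `G'` are congruent modulo the ideal of the four families and have the same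
out-degrees and in-degrees. -/
structure Rewires (K : Type*) [CommRing K] (a b : ℕ) (G G' : YIdx →₀ ℕ) : Prop where
  conn : Conn K a b G G'
  outDeg : ∀ i, outDeg i G = outDeg i G'
  inDeg : ∀ i, inDeg i G = inDeg i G'

section
variable {K : Type*} [CommRing K] {a b : ℕ} {G G' G'' : YIdx →₀ ℕ}

lemma Rewires.refl (G : YIdx →₀ ℕ) : Rewires K a b G G := ⟨Conn.refl G, fun _ => rfl, fun _ => rfl⟩

lemma Rewires.trans (h : Rewires K a b G G') (h' : Rewires K a b G' G'') : Rewires K a b G G'' :=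
  ⟨h.conn.trans h'.conn, fun i => (h.outDeg i).trans (h'.outDeg i),
    fun i => (h.inDeg i).trans (h'.inDeg i)⟩

lemma Rewires.add_right (h : Rewires K a b G G') (R : YIdx →₀ ℕ) :
    Rewires K a b (G + R) (G' + R) :=
  ⟨h.conn.add_right R, fun i => by rw [map_add, map_add, h.outDeg],
    fun i => by rw [map_add, map_add, h.inDeg]⟩

lemma Rewires.avoid (h : Rewires K a b G G') (i : ℕ) : avoid i G = avoid i G' := by
  have h1 := degree_eq_avoid_add i G
  have h2 := degree_eq_avoid_add i G'
  have h3 := degree_eq_of_outDeg_eq h.outDeg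
  have h4 := h.outDeg i
  have h5 := h.inDeg i
  omega

lemma exists_eq_two_add {p q : YIdx} (hpq : p ≠ q) (hp : 0 < G p) (hq : 0 < G q) :
    ∃ R, G = Finsupp.single p 1 + Finsupp.single q 1 + R := by
  classical
  refine exists_add_of_le fun x => ?_
  rw [Finsupp.add_apply, Finsupp.single_apply, Finsupp.single_apply]
  split_ifs with h h' h'
  · exact absurd (h.trans h'.symm) hpq
  · subst h; omega
  · subst h'; omega
  · simp

lemma exists_eq_three_add {p q r : YIdx} (hpq : p ≠ q) (hpr : p ≠ r) (hqr : q ≠ r)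
    (hp : 0 < G p) (hq : 0 < G q) (hr : 0 < G r) :
    ∃ R, G = Finsupp.single p 1 + Finsupp.single q 1 + Finsupp.single r 1 + R := by
  obtain ⟨R, rfl⟩ := exists_eq_two_add hpq hp hq
  have hr' : Finsupp.single r 1 ≤ R := by
    rw [Finsupp.single_le_iff]
    simpa [Finsupp.single_apply, hpr, hqr, Nat.one_le_iff_ne_zero, pos_iff_ne_zero] using hr
  obtain ⟨S, rfl⟩ := exists_add_of_le hr'
  exact ⟨S, by rw [add_assoc, add_assoc, add_assoc]⟩

lemma rewires_quadric (i j k l : ℕ) (hij : i ≠ j) (hkl : k ≠ l) (hil : i ≠ l) (hkj : k ≠ j)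
    (hik : i ≠ k) (hjl : j ≠ l) :
    Rewires K a b (edge i j hij + edge k l hkl) (edge i l hil + edge k j hkj) :=
  ⟨conn_quadric i j k l hij hkl hil hkj hik hjl, fun x => by simp [count_single],
    fun x => by simp [count_single, add_comm]⟩

lemma rewires_cubic (i j k : ℕ) (hij : i ≠ j) (hjk : j ≠ k) (hki : k ≠ i) :
    Rewires K a b (edge i j hij + edge j k hjk + edge k i hki)
      (edge j i hij.symm + edge k j hjk.symm + edge i k hki.symm) :=
  ⟨conn_cubic i j k hij hjk hki,
    fun x => by simp only [map_add, count_single]; ring,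
    fun x => by simp only [map_add, count_single]; ring⟩

lemma exists_rewires_of_two {i j k l : ℕ} (hij : i ≠ j) (hik : i ≠ k) (hlj : l ≠ j)
    (hkl : k ≠ l) (hil : i ≠ l) (hkj : k ≠ j)
    (h1 : 0 < G ⟨(i, k), hik⟩) (h2 : 0 < G ⟨(l, j), hlj⟩) :
    ∃ R, G = edge i k hik + edge l j hlj + R ∧
      Rewires K a b G (edge i j hij + (edge l k hkl.symm + R)) := by
  obtain ⟨R, hR⟩ := exists_eq_two_add (by simp [hil]) h1 h2
  refine ⟨R, hR, ?_⟩
  rw [hR, ← add_assoc]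
  exact (rewires_quadric i k l j hik hlj hij hkl.symm hil hkj).add_right R

/-- A missing edge from `i` to `j` can be produced if no third vertex meets all edges. -/
lemma exists_rewires_edge {i j : ℕ} (hij : i ≠ j) (hi : 0 < outDeg i G) (hj : 0 < inDeg j G)
    (hk : ∀ k, k ≠ i → k ≠ j → 0 < avoid k G) :
    ∃ R, Rewires K a b G (edge i j hij + R) := by
  by_cases h0 : 0 < G ⟨(i, j), hij⟩
  · obtain ⟨R, hR⟩ : ∃ R, G = edge i j hij + R :=
      exists_add_of_le (Finsupp.single_le_iff.2 h0)
    exact ⟨R, hR ▸ Rewires.refl G⟩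
  obtain ⟨⟨⟨i', k⟩, hik⟩, rfl, h1⟩ := exists_of_count_pos _ hi
  obtain ⟨⟨⟨l, j'⟩, hlj⟩, rfl, h2⟩ := exists_of_count_pos _ hj
  dsimp only at *
  have two {k l : ℕ} (hik : i' ≠ k) (hlj : l ≠ j') (hkl : k ≠ l) (h1 : 0 < G ⟨(i', k), hik⟩)
      (h2 : 0 < G ⟨(l, j'), hlj⟩) : ∃ R, Rewires K a b G (edge i' j' hij + R) := by
    have hkj : k ≠ j' := by rintro rfl; exact h0 h1
    have hil : i' ≠ l := by rintro rfl; exact h0 h2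
    obtain ⟨R, -, hR⟩ := exists_rewires_of_two (K := K) (a := a) (b := b) hij hik hlj hkl hil hkj h1 h2
    exact ⟨_, hR⟩
  -- With edges `i → k` and `l → j` a single quadric creates `i → j`, unless `k = l`, where it would
  -- create a loop.
  by_cases hkl : k = l
  swap
  · exact two hik hlj hkl h1 h2
  subst hkl
  -- An edge `s → t` that misses `k` breaks the deadlock. One quadric suffices if `s = i` or `t =
  -- j`, and two do in all other cases except `s = j`, `t = i`. There the edges form a 3-cycle, and
  -- the cubic reverses it.
  obtain ⟨⟨⟨s, t⟩, hst⟩, ⟨hsk, htk⟩, h3⟩ := exists_of_count_pos _ (hk k hik.symm hlj)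
  dsimp only at *
  by_cases hsi : s = i'
  · subst hsi
    exact two hst hlj htk h3 h2
  by_cases htj : t = j'
  · subst htj
    exact two hik hst hsk.symm h1 h3
  by_cases hti : t = i'
  · subst hti
    by_cases hsj : s = j'
    · subst hsj
      obtain ⟨R, hR⟩ := exists_eq_three_add (p := ⟨(t, k), hik⟩) (q := ⟨(k, s), hlj⟩)
        (r := ⟨(s, t), hst⟩) (by simp [hik]) (by simp [hij]) (by simp [hlj]) h1 h2 h3
      refine ⟨edge k t hik.symm + edge s k hlj.symm + R, ?_⟩
      have := (rewires_cubic (K := K) (a := a) (b := b) t k s hik hlj hst).add_right R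
      rw [← hR] at this
      convert this using 1
      abel
    · obtain ⟨R, hR⟩ := exists_eq_three_add (p := ⟨(k, j'), hlj⟩) (q := ⟨(s, t), hst⟩)
        (r := ⟨(t, k), hik⟩) (by simp [Ne.symm hsk]) (by simp [hik.symm])
        (by simp [hst]) h2 h3 h1
      have e1 := (rewires_quadric (K := K) (a := a) (b := b) k j' s t hlj hst hik.symm hsj
        (Ne.symm hsk) (Ne.symm htj)).add_right (edge t k hik + R)
      have e2 := (rewires_quadric (K := K) (a := a) (b := b) t k s j' hik hsj hij hsk
        hst.symm hlj).add_right (edge k t hik.symm + R)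
      refine ⟨edge s k hsk + (edge k t hik.symm + R), ?_⟩
      rw [← add_assoc, ← hR] at e1
      rw [← add_assoc]
      refine e1.trans ?_
      convert e2 using 1
      abel
  · obtain ⟨R, hR⟩ := exists_eq_three_add (p := ⟨(i', k), hik⟩) (q := ⟨(s, t), hst⟩)
      (r := ⟨(k, j'), hlj⟩) (by simp [Ne.symm hsi]) (by simp [hik])
      (by simp [hsk]) h1 h3 h2
    have e1 := (rewires_quadric (K := K) (a := a) (b := b) i' k s t hik hst (Ne.symm hti) hsk
      (Ne.symm hsi) (Ne.symm htk)).add_right (edge k j' hlj + R)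
    have e2 := (rewires_quadric (K := K) (a := a) (b := b) i' t k j' (Ne.symm hti) hlj hij
      (Ne.symm htk) hik htj).add_right (edge s k hsk + R)
    refine ⟨edge k t (Ne.symm htk) + (edge s k hsk + R), ?_⟩
    rw [← add_assoc, ← hR] at e1
    rw [← add_assoc]
    refine e1.trans ?_
    convert e2 using 1
    abel

/-- Multigraphs with the same out-degrees and in-degrees are congruent. -/
lemma conn_of_degrees_eq {G H : YIdx →₀ ℕ} (ho : ∀ i, outDeg i G = outDeg i H)
    (hi : ∀ i, inDeg i G = inDeg i H) : Conn K a b G H := by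
  obtain ⟨N, hN⟩ : ∃ N, G.degree = N := ⟨_, rfl⟩
  have hdeg := degree_eq_of_outDeg_eq ho
  induction N generalizing G H with
  | zero =>
    rw [hN] at hdeg
    rw [Finsupp.degree_eq_zero_iff] at hN
    rw [eq_comm, Finsupp.degree_eq_zero_iff] at hdeg
    rw [hN, hdeg]
    exact Conn.refl 0
  | succ N ih =>
    have hH : H ≠ 0 := by rintro rfl; rw [map_zero] at hdeg; omega
    obtain ⟨p, hp⟩ := Finsupp.support_nonempty_iff.2 hH
    have hp' : 0 < H p := Nat.pos_of_ne_zero (by simpa using hp)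
    obtain ⟨⟨i, j⟩, hij⟩ := p
    obtain ⟨R, hR⟩ := exists_rewires_edge (K := K) (a := a) (b := b) (G := G) hij
      (by rw [ho]; exact hp'.trans_le (le_count _ rfl))
      (by rw [hi]; exact hp'.trans_le (le_count _ rfl))
      -- The edge `i → j` of `H` avoids `k`, and `G` has as many edges avoiding `k` as `H`, since
      -- the degrees agree.
      (fun k hki hkj => by
        have h1 := degree_eq_avoid_add k G
        have h2 := degree_eq_avoid_add k H
        have h3 : H ⟨(i, j), hij⟩ ≤ avoid k H := le_count _ ⟨hki.symm, hkj.symm⟩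
        have h4 := ho k
        have h5 := hi k
        omega)
    obtain ⟨S, rfl⟩ : ∃ S, H = edge i j hij + S :=
      exists_add_of_le (Finsupp.single_le_iff.2 hp')
    have hRo (x) : outDeg x R = outDeg x S := by
      have h1 := (hR.outDeg x).symm.trans (ho x)
      rw [map_add, map_add] at h1
      exact Nat.add_left_cancel h1
    have hRi (x) : inDeg x R = inDeg x S := by
      have h1 := (hR.inDeg x).symm.trans (hi x)
      rw [map_add, map_add] at h1
      exact Nat.add_left_cancel h1
    have hRN : R.degree = N := by
      have := degree_eq_of_outDeg_eq hR.outDeg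
      rw [map_add, Finsupp.degree_single] at this
      omega
    have := (ih hRo hRi hRN (degree_eq_of_outDeg_eq hRo)).add_right (edge i j hij)
    rw [add_comm R, add_comm S] at this
    exact hR.conn.trans this

end


/-! ### Exchange moves -/

lemma count_eq_apply (p : YIdx) (P : YIdx → Prop) [DecidablePred P] (hP : ∀ q, P q ↔ q = p)
    (G : YIdx →₀ ℕ) : count P G = G p := by
  induction G using Finsupp.induction_linear with
  | zero => simp
  | add f g hf hg => simp only [map_add, hf, hg, Finsupp.add_apply]
  | single q n => classical simp [count_single, hP, Finsupp.single_apply]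

lemma count_mapDomain (f : YIdx → YIdx) (P : YIdx → Prop) [DecidablePred P] (G : YIdx →₀ ℕ) :
    count P (G.mapDomain f) = count (fun p => P (f p)) G := by
  induction G using Finsupp.induction_linear with
  | zero => simp
  | add f g hf hg => simp only [map_add, hf, hg, Finsupp.mapDomain_add]
  | single q n => simp [count_single, Finsupp.mapDomain_single]

lemma outDeg_swapped (i j k : ℕ) (G : YIdx →₀ ℕ) :
    outDeg k (swapped i j G) = outDeg (Equiv.swap i j k) G := by
  rw [swapped, outDeg, count_mapDomain]
  congr 1
  simp only [permPair]
  congr 1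
  funext p
  rw [Equiv.swap_apply_eq_iff]

/-- The number of edges into `j` that do not come from `i`. -/
noncomputable abbrev inOther (i j : ℕ) : (YIdx →₀ ℕ) →+ ℕ :=
  count fun p => p.1.2 = j ∧ p.1.1 ≠ i

/-- The number of edges out of `j` that do not go to `i`. -/
noncomputable abbrev outOther (i j : ℕ) : (YIdx →₀ ℕ) →+ ℕ :=
  count fun p => p.1.1 = j ∧ p.1.2 ≠ i

/-- The number of edges that are incident to neither `i` nor `j`. -/
noncomputable abbrev avoidBoth (i j : ℕ) : (YIdx →₀ ℕ) →+ ℕ :=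
  count fun p => (p.1.1 ≠ i ∧ p.1.2 ≠ i) ∧ p.1.1 ≠ j ∧ p.1.2 ≠ j

lemma inDeg_eq_add {i j : ℕ} (hij : i ≠ j) (G : YIdx →₀ ℕ) :
    inDeg j G = G ⟨(i, j), hij⟩ + inOther i j G := by
  rw [← count_eq_apply ⟨(i, j), hij⟩ (fun p => p.1.1 = i ∧ p.1.2 = j)
    (fun q => by rw [Subtype.ext_iff, Prod.ext_iff])]
  exact count_union _ _ _ (fun p => by tauto) (fun p => by tauto) G

lemma outDeg_eq_add {i j : ℕ} (hij : i ≠ j) (G : YIdx →₀ ℕ) :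
    outDeg i G = G ⟨(i, j), hij⟩ + outOther j i G := by
  rw [← count_eq_apply ⟨(i, j), hij⟩ (fun p => p.1.1 = i ∧ p.1.2 = j)
    (fun q => by rw [Subtype.ext_iff, Prod.ext_iff])]
  exact count_union _ _ _ (fun p => by tauto) (fun p => by tauto) G

lemma avoid_eq_add {i j : ℕ} (hij : i ≠ j) (G : YIdx →₀ ℕ) :
    avoid i G = inOther i j G + outOther i j G + avoidBoth i j G := by
  rw [← count_union (fun p => p.1.2 = j ∧ p.1.1 ≠ i) (fun p => p.1.1 = j ∧ p.1.2 ≠ i)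
    (fun p => (p.1.2 = j ∧ p.1.1 ≠ i) ∨ (p.1.1 = j ∧ p.1.2 ≠ i)) (fun p => Iff.rfl)
    (fun p h h' => p.2 (h'.1.trans h.1.symm))]
  refine count_union _ _ _ (fun p => ?_) (fun p => by tauto) G
  have : p.1.1 = j → p.1.1 ≠ i := fun h h' => hij (h'.symm.trans h)
  have : p.1.2 = j → p.1.2 ≠ i := fun h h' => hij (h'.symm.trans h)
  tauto

/-- Up to a rewiring, `G` contains a multigraph that is congruent to its mirror image under
`i ↔ j` and in which the out-degree of `i` exceeds that of `j` by `b`. -/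
def Exchangeable (K : Type*) [CommRing K] (a b i j : ℕ) (G : YIdx →₀ ℕ) : Prop :=
  ∃ U R, Rewires K a b G (U + R) ∧ Conn K a b U (swapped i j U) ∧ outDeg i U = outDeg j U + b

section
variable {K : Type*} [CommRing K] {a b i j : ℕ} {G G' : YIdx →₀ ℕ}

lemma Exchangeable.of_rewires (h : Rewires K a b G G') (h' : Exchangeable K a b i j G') :
    Exchangeable K a b i j G := by
  obtain ⟨U, R, h1, h2, h3⟩ := h'
  exact ⟨U, R, h.trans h1, h2, h3⟩

lemma Exchangeable.exists_conn (h : Exchangeable K a b i j G) :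
    ∃ G', Conn K a b G G' ∧ outDeg i G = outDeg i G' + b ∧ outDeg j G' = outDeg j G + b ∧
      ∀ k, k ≠ i → k ≠ j → outDeg k G' = outDeg k G := by
  obtain ⟨U, R, h1, h2, h3⟩ := h
  refine ⟨swapped i j U + R, h1.conn.trans (h2.add_right R), ?_, ?_, fun k hi hj => ?_⟩
  · rw [h1.outDeg, map_add, map_add, outDeg_swapped, Equiv.swap_apply_left, h3]
    ring
  · rw [h1.outDeg, map_add, map_add, outDeg_swapped, Equiv.swap_apply_right, h3]
    ring
  · rw [h1.outDeg, map_add, map_add, outDeg_swapped, Equiv.swap_apply_of_ne_of_ne hi hj]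

lemma exchangeable_of_three (hij : i ≠ j) (hm : b ≤ G ⟨(i, j), hij⟩)
    (hq : a ≤ G ⟨(i, j), hij⟩ + inOther i j G) (hr : a - b ≤ inOther i j G + outOther i j G) :
    Exchangeable K a b i j G := by
  classical
  -- The parameter `n` is the shortage of edges entering `j` from elsewhere; it is made up by edges
  -- leaving `j`. Truncated subtraction gives `n = 0` when there is no shortage.
  obtain ⟨n, hn, hnq, hnr, hnm⟩ : ∃ n ≤ a - b, a - b - n ≤ inOther i j G ∧
      n ≤ outOther i j G ∧ b + n ≤ G ⟨(i, j), hij⟩ :=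
    ⟨a - b - inOther i j G, by omega, by omega, by omega, by omega⟩
  obtain ⟨A, hAG, hAn, hA⟩ := exists_le_of_le_count _ hnq
  obtain ⟨B, hBG, hBn, hB⟩ := exists_le_of_le_count _ hnr
  set U := Finsupp.single (⟨(i, j), hij⟩ : YIdx) (b + n) + (A + B) with hU
  have hUG : U ≤ G := by
    intro p
    have hA0 : A p ≠ 0 → p.1.2 = j ∧ p.1.1 ≠ i := fun h => hA p (by simpa using h)
    have hB0 : B p ≠ 0 → p.1.1 = j ∧ p.1.2 ≠ i := fun h => hB p (by simpa using h)
    have h1 := hAG p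
    have h2 := hBG p
    rw [hU, Finsupp.add_apply, Finsupp.add_apply, Finsupp.single_apply]
    split_ifs with h
    · subst h
      have h3 : A ⟨(i, j), hij⟩ = 0 := by by_contra h; exact (hA0 h).2 rfl
      have h4 : B ⟨(i, j), hij⟩ = 0 := by by_contra h; exact hij (hB0 h).1
      omega
    · by_cases h3 : A p = 0
      · omega
      · have h4 : B p = 0 := by
          by_contra h; exact p.2 ((hB0 h).1.trans (hA0 h3).1.symm)
        omega
  obtain ⟨R, hR⟩ := exists_add_of_le hUG
  refine ⟨U, R, hR ▸ Rewires.refl G, conn_three i j hij hn hA hB hAn hBn hU, ?_⟩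
  have hAi : outDeg i A = 0 := count_eq_zero _ fun p hp => (hA p hp).2
  have hAj : outDeg j A = 0 := count_eq_zero _ fun p hp h => p.2 (h.trans (hA p hp).1.symm)
  have hBi : outDeg i B = 0 := count_eq_zero _ fun p hp h => hij (h.symm.trans (hB p hp).1)
  have hBj : outDeg j B = n := by rw [outDeg, count_eq_degree _ fun p hp => (hB p hp).1, hBn]
  simp only [hU, map_add, hAi, hAj, hBi, hBj, count_single, hij, if_true, if_false]
  ring

/-- If too few edges join `j` to vertices other than `i`, some edge avoids both `i` and `j`. A
quadric trades it and one copy of `i → j` for an edge out of `i` and an edge into `j`, which lowers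
the multiplicity of `i → j`. -/
lemma exchangeable_of_many (hij : i ≠ j) (hm : b ≤ G ⟨(i, j), hij⟩)
    (hj : a ≤ inDeg j G) (hr : a - b ≤ avoid i G) : Exchangeable K a b i j G := by
  classical
  obtain ⟨m, hGm⟩ : ∃ m, G ⟨(i, j), hij⟩ = m := ⟨_, rfl⟩
  induction m using Nat.strong_induction_on generalizing G with
  | _ m ih =>
  have hj' := inDeg_eq_add hij G
  have hr' := avoid_eq_add hij G
  by_cases h : a - b ≤ inOther i j G + outOther i j G
  · exact exchangeable_of_three hij hm (hj' ▸ hj) h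
  obtain ⟨⟨⟨k, l⟩, hkl⟩, ⟨⟨hki, hli⟩, hkj, hlj⟩, hG⟩ :=
    exists_of_count_pos _ (show 0 < avoidBoth i j G by omega)
  dsimp only at *
  obtain ⟨R, hR⟩ := exists_eq_two_add (p := ⟨(i, j), hij⟩) (q := ⟨(k, l), hkl⟩)
    (by simp [hki.symm]) (by omega) hG
  have hrew := (rewires_quadric (K := K) (a := a) (b := b) i j k l hij hkl hli.symm hkj
    hki.symm hlj.symm).add_right R
  rw [← hR] at hrew
  have hm' : (edge i l hli.symm + edge k j hkj + R) ⟨(i, j), hij⟩ + 1 = G ⟨(i, j), hij⟩ := by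
    conv_rhs => rw [hR]
    simp [hlj, hki]
    ring
  -- The multiplicity of `i → j` stays at least `b`: it was larger than `b`, because `j` has
  -- in-degree at least `a` but fewer than `a - b` edges from elsewhere.
  exact Exchangeable.of_rewires hrew (ih (m - 1) (by omega) (by omega)
    (hrew.inDeg j ▸ hj) (hrew.avoid i ▸ hr) (by omega))

/-- Quadrics raise the multiplicity of `i → j` until it reaches `b`, where type (iii) takes over. If
they get stuck earlier, all remaining edges out of `i` and into `j` pass through one vertex `k`, and
type (iv) applies. -/
lemma exchangeable_of_degrees (hab : b < a) (hij : i ≠ j) (hi : b ≤ outDeg i G)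
    (hj : a ≤ inDeg j G) (hr : a - b ≤ avoid i G) : Exchangeable K a b i j G := by
  classical
  obtain ⟨m, hGm⟩ : ∃ m, b - G ⟨(i, j), hij⟩ = m := ⟨_, rfl⟩
  induction m generalizing G with
  | zero => exact exchangeable_of_many hij (by omega) hj hr
  | succ m ih =>
    have hj' := inDeg_eq_add hij G
    have hi' := outDeg_eq_add hij G
    by_cases hex : ∃ (k l : ℕ) (hik : i ≠ k) (hlj : l ≠ j), k ≠ l ∧ i ≠ l ∧ k ≠ j ∧
        0 < G ⟨(i, k), hik⟩ ∧ 0 < G ⟨(l, j), hlj⟩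
    · obtain ⟨k, l, hik, hlj, hkl, hil, hkj, h1, h2⟩ := hex
      obtain ⟨R, hR, hrew⟩ := exists_rewires_of_two (K := K) (a := a) (b := b) hij hik hlj hkl
        hil hkj h1 h2
      have hm' : (edge i j hij + (edge l k hkl.symm + R)) ⟨(i, j), hij⟩
          = G ⟨(i, j), hij⟩ + 1 := by
        conv_rhs => rw [hR]
        simp [hil.symm, hkj]
        ring
      exact Exchangeable.of_rewires hrew (ih (hrew.outDeg i ▸ hi) (hrew.inDeg j ▸ hj)
        (hrew.avoid i ▸ hr) (by omega))
    · have heq {k l : ℕ} (hik : i ≠ k) (hlj : l ≠ j) (hil : i ≠ l) (hkj : k ≠ j)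
          (h1 : 0 < G ⟨(i, k), hik⟩) (h2 : 0 < G ⟨(l, j), hlj⟩) : k = l := by
        by_contra hkl
        exact hex ⟨k, l, hik, hlj, hkl, hil, hkj, h1, h2⟩
      have hpos₁ : 0 < outOther j i G := by omega
      have hpos₂ : 0 < inOther i j G := by omega
      obtain ⟨⟨⟨i', k⟩, hik⟩, ⟨hi₀, hkj⟩, h1⟩ := exists_of_count_pos _ hpos₁
      obtain ⟨⟨⟨l, j'⟩, hlj⟩, ⟨hj₀, hil⟩, h2⟩ := exists_of_count_pos _ hpos₂
      dsimp only at hi₀ hj₀ hik hkj hlj hil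
      subst hi₀ hj₀
      obtain rfl := heq hik hlj hil.symm hkj h1 h2
      have hout : outOther j' i' G ≤ G ⟨(i', k), hik⟩ := by
        rw [count_eq_degree_filter, ← Finsupp.degree_single (⟨(i', k), hik⟩ : YIdx) (G _)]
        refine Finsupp.degree_mono fun p => ?_
        rw [Finsupp.filter_apply, Finsupp.single_apply]
        split_ifs with hp hp' hp'
        · rw [hp']
        · by_contra hlt
          obtain ⟨⟨s, t⟩, hst⟩ := p
          obtain ⟨hs, ht⟩ := hp
          dsimp only at hs ht
          subst hs
          have : t = k := heq hst hlj hil.symm ht (by omega) h2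
          subst this
          exact hp' rfl
        · simp
        · simp
      have hin : inOther i' j' G ≤ G ⟨(k, j'), hlj⟩ := by
        rw [count_eq_degree_filter, ← Finsupp.degree_single (⟨(k, j'), hlj⟩ : YIdx) (G _)]
        refine Finsupp.degree_mono fun p => ?_
        rw [Finsupp.filter_apply, Finsupp.single_apply]
        split_ifs with hp hp' hp'
        · rw [hp']
        · by_contra hlt
          obtain ⟨⟨s, t⟩, hst⟩ := p
          obtain ⟨ht, hs⟩ := hp
          dsimp only at hs ht
          subst ht
          have : k = s := heq hik hst (Ne.symm hs) hkj h1 (by omega)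
          subst this
          exact hp' rfl
        · simp
        · simp
      -- `n` is the number of copies of `i → j` still missing. The degree bounds give at least `n`
      -- copies of `i → k` and `a - b + n` copies of `k → j`.
      set n := b - G ⟨(i', j'), hij⟩ with hn
      set U := Finsupp.single (⟨(i', j'), hij⟩ : YIdx) (b - n)
        + Finsupp.single (⟨(i', k), hik⟩ : YIdx) n
        + Finsupp.single (⟨(k, j'), hlj⟩ : YIdx) (a - b + n) with hU
      have hUG : U ≤ G := by
        intro p
        rw [hU, Finsupp.add_apply, Finsupp.add_apply, Finsupp.single_apply, Finsupp.single_apply,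
          Finsupp.single_apply]
        by_cases hp1 : (⟨(i', j'), hij⟩ : YIdx) = p
        · subst hp1
          simp [hkj, hil]
          omega
        by_cases hp2 : (⟨(i', k), hik⟩ : YIdx) = p
        · subst hp2
          simp [hil, hkj.symm]
          omega
        by_cases hp3 : (⟨(k, j'), hlj⟩ : YIdx) = p
        · subst hp3
          simp [hil.symm]
          omega
        simp [hp1, hp2, hp3]
      obtain ⟨R, hR⟩ := exists_add_of_le hUG
      refine ⟨U, R, hR ▸ Rewires.refl G,
        conn_four i' j' k hij hik hlj (by omega) (by omega) hU, ?_⟩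
      simp only [hU, map_add, count_single, hij, hil, hlj, if_true, if_false]
      omega

end

/-! ### The four families generate the kernel -/

section
variable {K : Type*} [CommRing K] {a b : ℕ} {G H : YIdx →₀ ℕ}

lemma degree_eq_of_expo_eq (hab : 0 < a + b) (h : expo a b G = expo a b H) :
    G.degree = H.degree := by
  have h1 := degree_expo a b G
  rw [h, degree_expo] at h1
  exact (Nat.eq_of_mul_eq_mul_left hab h1).symm

/-- At `i`, `a` times the loss of out-degree equals `b` times the gain of in-degree, so coprimality
makes `b` divide the former. -/
lemma le_sub_of_expo_eq (hb : 1 ≤ b) (hcop : Nat.Coprime a b)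
    (h : expo a b G = expo a b H) {i : ℕ} (hi : outDeg i H < outDeg i G) :
    ∃ d, 0 < d ∧ outDeg i G = outDeg i H + b * d ∧ inDeg i H = inDeg i G + a * d := by
  have h1 := expo_eq_iff.1 h i
  obtain ⟨x, hx⟩ := Nat.exists_eq_add_of_lt hi
  have h2 : a * (x + 1) + b * inDeg i G = b * inDeg i H := by
    rw [hx] at h1
    linarith
  have h3 : b ∣ x + 1 := by
    refine hcop.symm.dvd_of_dvd_mul_left ((Nat.dvd_add_left (dvd_mul_right b (inDeg i G))).1 ?_)
    rw [h2]
    exact dvd_mul_right _ _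
  obtain ⟨d, hd⟩ := h3
  refine ⟨d, Nat.pos_of_ne_zero (by rintro rfl; simp at hd), by omega, ?_⟩
  rw [hd] at h2
  refine Nat.eq_of_mul_eq_mul_left hb ?_
  linarith

lemma exists_outDeg_lt (hdeg : G.degree = H.degree) (hne : ∃ i, outDeg i G ≠ outDeg i H) :
    ∃ i, outDeg i G < outDeg i H := by
  by_contra! hle
  obtain ⟨R, hR⟩ : ∃ R, G.mapDomain (fun p : YIdx => p.1.1)
      = H.mapDomain (fun p : YIdx => p.1.1) + R := by
    refine exists_add_of_le fun i => ?_
    rw [mapDomain_fst_apply, mapDomain_fst_apply]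
    exact hle i
  have h1 := congrArg Finsupp.degree hR
  rw [map_add, Finsupp.degree_mapDomain, Finsupp.degree_mapDomain, hdeg, left_eq_add,
    Finsupp.degree_eq_zero_iff] at h1
  obtain ⟨i, hi⟩ := hne
  apply hi
  rw [← mapDomain_fst_apply, ← mapDomain_fst_apply, hR, h1, add_zero]

/-- A vertex whose out-degree in `G` is too small would need in-degree at least `a` in `G`. Without
such a vertex there is no surplus either, as the totals agree. -/
lemma outDeg_eq_of_inDeg_lt (hb : 1 ≤ b) (hcop : Nat.Coprime a b)
    (h : expo a b G = expo a b H) (hG : ∀ i, inDeg i G < a) (i : ℕ) :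
    outDeg i G = outDeg i H := by
  by_contra hi
  obtain ⟨j, hj⟩ := exists_outDeg_lt (degree_eq_of_expo_eq (by omega) h) ⟨i, hi⟩
  obtain ⟨d, hd, -, hin⟩ := le_sub_of_expo_eq hb hcop h.symm hj
  have := hG j
  have : a * 1 ≤ a * d := Nat.mul_le_mul_left a hd
  omega

lemma inDeg_eq_of_outDeg_eq (hb : 1 ≤ b) (h : expo a b G = expo a b H) {i : ℕ}
    (hi : outDeg i G = outDeg i H) : inDeg i G = inDeg i H := by
  have := expo_eq_iff.1 h i
  rw [hi] at this
  exact Nat.eq_of_mul_eq_mul_left hb (Nat.add_left_cancel this)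

end


/-! ### The four families lie in the kernel -/

lemma inDeg_swapped (i j k : ℕ) (G : YIdx →₀ ℕ) :
    inDeg k (swapped i j G) = inDeg (Equiv.swap i j k) G := by
  rw [swapped, inDeg, count_mapDomain]
  congr 1
  simp only [permPair]
  congr 1
  funext p
  rw [Equiv.swap_apply_eq_iff]

lemma expo_swapped {a b i j : ℕ} {G : YIdx →₀ ℕ} (h : expo a b G i = expo a b G j) :
    expo a b (swapped i j G) = expo a b G := by
  have key (k : ℕ) : expo a b (swapped i j G) k = expo a b G (Equiv.swap i j k) := by
    rw [expo_apply, expo_apply, outDeg_swapped, inDeg_swapped]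
  ext k
  rw [key]
  rcases eq_or_ne k i with rfl | hi
  · rw [Equiv.swap_apply_left, h]
  rcases eq_or_ne k j with rfl | hj
  · rw [Equiv.swap_apply_right, h]
  · rw [Equiv.swap_apply_of_ne_of_ne hi hj]

lemma count_mapDomain_nat (f : ℕ → YIdx) (P : YIdx → Prop) [DecidablePred P] (c : ℕ →₀ ℕ)
    {Q : Prop} [Decidable Q] (hQ : ∀ k, P (f k) ↔ Q) :
    count P (c.mapDomain f) = if Q then c.degree else 0 := by
  induction c using Finsupp.induction_linear with
  | zero => simp
  | add f g hf hg => rw [Finsupp.mapDomain_add, map_add, hf, hg, map_add]; split_ifs <;> simp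
  | single k n => simp [count_single, Finsupp.mapDomain_single, hQ]

/-- Vertex `0` has out-degree `b + n` and in-degree `0`, vertex `1` has out-degree `n` and in-degree
`a`; both get `a * (b + n)`. By `expo_swapped` the mirror image then lies in the same fiber. -/
lemma expo_threeExp {a b n : ℕ} {c₁ c₂ : ℕ →₀ ℕ} (hab : b < a) (hn : n ≤ a - b)
    (h₁ : c₁.degree = a - b - n) (h₂ : c₂.degree = n) :
    expo a b (threeExp b n c₁ c₂) 0 = expo a b (threeExp b n c₁ c₂) 1 := by
  obtain ⟨m, rfl⟩ : ∃ m, a = b + n + m := ⟨a - b - n, by omega⟩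
  have hm : c₁.degree = m := by omega
  rw [expo_apply, expo_apply, threeExp]
  simp only [map_add, count_single]
  rw [count_mapDomain_nat (Q := False) _ _ _ (by simp),
    count_mapDomain_nat (Q := False) _ _ _ (by simp),
    count_mapDomain_nat (Q := False) _ _ _ (by simp),
    count_mapDomain_nat (Q := False) _ _ _ (by simp),
    count_mapDomain_nat (Q := False) _ _ _ (by simp),
    count_mapDomain_nat (Q := True) _ _ _ (by simp),
    count_mapDomain_nat (Q := True) _ _ _ (by simp),
    count_mapDomain_nat (Q := False) _ _ _ (by simp), hm, h₂]
  simp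
  ring

lemma expo_fourExp {a b n : ℕ} (hab : b < a) (hn : n ≤ b) :
    expo a b (fourExp a b n) 0 = expo a b (fourExp a b n) 1 := by
  obtain ⟨c, rfl⟩ := exists_add_of_le hn
  obtain ⟨d, rfl⟩ := exists_add_of_le hab.le
  rw [expo_apply, expo_apply, fourExp]
  simp [count_single]
  ring

lemma markovFamily_subset (K : Type*) [CommRing K] [Nontrivial K] {a b : ℕ} (hab : b < a) :
    markovFamily K a b ⊆ toricIdeal K a b := by
  rintro f (rfl | rfl | ⟨n, c₁, c₂, hn, h₁, h₂, rfl⟩ | ⟨n, -, hn, rfl⟩)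
  · rw [SetLike.mem_coe, basicQuadric_eq, monomial_sub_mem_toricIdeal, expo_eq_iff]
    intro i
    simp only [map_add, count_single]
    ring
  · rw [SetLike.mem_coe, threeCycleCubic_eq, monomial_sub_mem_toricIdeal, expo_eq_iff]
    intro i
    simp only [map_add, count_single]
    ring
  · rw [SetLike.mem_coe, familyThree_eq, monomial_sub_mem_toricIdeal,
      expo_swapped (expo_threeExp hab hn h₁ h₂)]
  · rw [SetLike.mem_coe, familyFour_eq, monomial_sub_mem_toricIdeal,
      expo_swapped (expo_fourExp hab hn)]

section
variable {K : Type*} [CommRing K] [Nontrivial K] {a b : ℕ}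

lemma Conn.expo_eq (hab : b < a) {G H : YIdx →₀ ℕ} (h : Conn K a b G H) :
    expo a b G = expo a b H :=
  monomial_sub_mem_toricIdeal.1 (span_orbits_le (markovFamily_subset K hab) h)

/-- Monomials with the same image under `π` are congruent modulo the four families. -/
lemma conn_of_expo_eq (hb : 1 ≤ b) (hab : b < a) (hcop : Nat.Coprime a b) {G H : YIdx →₀ ℕ}
    (h : expo a b G = expo a b H) : Conn K a b G H := by
  -- `N` is the total surplus of out-degree of `G` over `H`; the subtraction is truncated, so
  -- deficits count as zero.
  obtain ⟨N, hN⟩ : ∃ N, (G.mapDomain (fun p : YIdx => p.1.1)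
    - H.mapDomain (fun p : YIdx => p.1.1)).degree = N := ⟨_, rfl⟩
  induction N using Nat.strong_induction_on generalizing G with
  | _ N ih =>
  by_cases hne : ∃ i, outDeg i G ≠ outDeg i H
  swap
  · push Not at hne
    exact conn_of_degrees_eq hne fun i => inDeg_eq_of_outDeg_eq hb h (hne i)
  have hdeg := degree_eq_of_expo_eq (by omega) h
  obtain ⟨j, hj⟩ := exists_outDeg_lt hdeg hne
  obtain ⟨i, hi⟩ := exists_outDeg_lt hdeg.symm (by simpa only [ne_comm] using hne)
  obtain ⟨d, hd, hdo, hdi⟩ := le_sub_of_expo_eq hb hcop h hi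
  obtain ⟨e, he, heo, hei⟩ := le_sub_of_expo_eq hb hcop h.symm hj
  have hbd : b * 1 ≤ b * d := Nat.mul_le_mul_left b hd
  have had : (a - b) * 1 ≤ (a - b) * d := Nat.mul_le_mul_left _ hd
  have had' : (a - b) * d + b * d = a * d := by rw [← Nat.add_mul, Nat.sub_add_cancel hab.le]
  have hae : a * 1 ≤ a * e := Nat.mul_le_mul_left a he
  have hbe : b * 1 ≤ b * e := Nat.mul_le_mul_left b he
  have hG := degree_eq_avoid_add i G
  have hH := degree_eq_avoid_add i H
  have hij : i ≠ j := by rintro rfl; omega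
  obtain ⟨G', hc, hi', hj', hk'⟩ := (exchangeable_of_degrees (K := K) (G := G) hab hij
    (by omega) (by omega) (by omega)).exists_conn
  refine hc.trans (ih _ ?_ ((hc.expo_eq hab).symm.trans h) rfl)
  -- The surplus drops by `b ≥ 1` at `i`. At `j` it remains zero, because the deficit there was at
  -- least `b`.
  rw [← hN, ← Nat.add_one_le_iff, ← Finsupp.degree_single i 1, ← map_add]
  refine Finsupp.degree_mono fun k => ?_
  rw [Finsupp.add_apply, Finsupp.tsub_apply, Finsupp.tsub_apply, mapDomain_fst_apply,
    mapDomain_fst_apply, mapDomain_fst_apply]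
  rcases eq_or_ne k i with rfl | hki
  · rw [Finsupp.single_eq_same]
    omega
  rw [Finsupp.single_eq_of_ne hki]
  rcases eq_or_ne k j with rfl | hkj
  · omega
  · rw [hk' k hki hkj, add_zero]

lemma isEquivariantMarkovBasis_markovFamily (hb : 1 ≤ b) (hab : b < a)
    (hcop : Nat.Coprime a b) : IsEquivariantMarkovBasis a b (markovFamily K a b) :=
  le_antisymm (span_orbits_le (markovFamily_subset K hab))
    (toricIdeal_le _ fun _ _ h => conn_of_expo_eq hb hab hcop h)

/-! ### Degrees -/

lemma totalDegree_monomial_sub {u v : YIdx →₀ ℕ} (hne : u ≠ v) (h : u.degree = v.degree) :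
    totalDegree (monomial u (1 : K) - monomial v 1) = u.degree := by
  classical
  apply le_antisymm
  · refine (totalDegree_sub _ _).trans ?_
    rw [totalDegree_monomial _ one_ne_zero, totalDegree_monomial _ one_ne_zero]
    exact max_le le_rfl h.symm.le
  · refine le_totalDegree (s := u) ?_
    rw [mem_support_iff, coeff_sub, coeff_monomial, coeff_monomial, if_pos rfl,
      if_neg hne.symm, sub_zero]
    exact one_ne_zero

lemma degree_swapped (i j : ℕ) (G : YIdx →₀ ℕ) : (swapped i j G).degree = G.degree :=
  Finsupp.degree_mapDomain _ _

lemma degree_threeExp (b n : ℕ) (c₁ c₂ : ℕ →₀ ℕ) :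
    (threeExp b n c₁ c₂).degree = b + n + (c₁.degree + c₂.degree) := by
  simp only [threeExp, map_add, Finsupp.degree_single, Finsupp.degree_mapDomain]

lemma degree_fourExp (a b n : ℕ) :
    (fourExp a b n).degree = b - n + n + (a - b + n) := by
  simp only [fourExp, map_add, Finsupp.degree_single]

lemma ne_swapped_of_outDeg_ne {G : YIdx →₀ ℕ} (h : outDeg 0 G ≠ outDeg 1 G) :
    G ≠ swapped 0 1 G := by
  intro h'
  apply h
  conv_lhs => rw [h']
  rw [outDeg_swapped, Equiv.swap_apply_left]

lemma totalDegree_familyThree {n : ℕ} (hb : 1 ≤ b) (c₁ c₂ : ℕ →₀ ℕ) (h₂ : c₂.degree = n) :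
    totalDegree (familyThree K b n c₁ c₂) = b + n + (c₁.degree + c₂.degree) := by
  rw [familyThree_eq, totalDegree_monomial_sub _ (degree_swapped _ _ _).symm, degree_threeExp]
  refine ne_swapped_of_outDeg_ne ?_
  rw [threeExp]
  simp only [map_add, count_single]
  rw [count_mapDomain_nat (Q := False) _ _ _ (by simp),
    count_mapDomain_nat (Q := False) _ _ _ (by simp),
    count_mapDomain_nat (Q := False) _ _ _ (by simp),
    count_mapDomain_nat (Q := True) _ _ _ (by simp), h₂]
  simp
  omega

lemma totalDegree_familyFour {n : ℕ} (hb : 1 ≤ b) :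
    totalDegree (familyFour K a b n) = b - n + n + (a - b + n) := by
  rw [familyFour_eq, totalDegree_monomial_sub _ (degree_swapped _ _ _).symm, degree_fourExp]
  refine ne_swapped_of_outDeg_ne ?_
  simp only [fourExp, map_add, count_single]
  simp
  omega

lemma totalDegree_monomial_sub_le (u v : YIdx →₀ ℕ) :
    totalDegree (monomial u (1 : K) - monomial v 1) ≤ max u.degree v.degree := by
  refine (totalDegree_sub _ _).trans ?_
  rw [totalDegree_monomial _ one_ne_zero, totalDegree_monomial _ one_ne_zero]
  exact le_rfl

lemma isGreatest_totalDegree_markovFamily (hb : 1 ≤ b) (hab : b < a) :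
    IsGreatest (totalDegree '' markovFamily K a b) (max (a + b) (2 * a - b)) := by
  constructor
  · rcases le_total (a + b) (2 * a - b) with h | h
    · rw [max_eq_right h]
      -- Type (iii) has degree `a + n` with `n ≤ a - b`, and type (iv) has degree `a + n` with `n ≤
      -- b`, so the largest `n` is taken in each.
      refine ⟨_, Or.inr (Or.inr (Or.inl ⟨a - b, 0, Finsupp.single 0 (a - b), le_rfl, by simp,
        Finsupp.sum_single_index rfl, rfl⟩)), ?_⟩
      rw [totalDegree_familyThree hb _ _ (Finsupp.degree_single _ _), Finsupp.degree_single,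
        map_zero]
      omega
    · rw [max_eq_left h]
      refine ⟨_, Or.inr (Or.inr (Or.inr ⟨b, hb, le_rfl, rfl⟩)), ?_⟩
      rw [totalDegree_familyFour hb]
      omega
  · rintro _ ⟨f, rfl | rfl | ⟨n, c₁, c₂, hn, h₁, h₂, rfl⟩ | ⟨n, -, hn, rfl⟩, rfl⟩
    · rw [basicQuadric_eq]
      refine (totalDegree_monomial_sub_le _ _).trans ?_
      simp
      omega
    · rw [threeCycleCubic_eq]
      refine (totalDegree_monomial_sub_le _ _).trans ?_
      simp
      omega
    · change c₁.degree = _ at h₁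
      change c₂.degree = _ at h₂
      rw [totalDegree_familyThree hb _ _ h₂, h₁, h₂]
      omega
    · rw [totalDegree_familyFour hb]
      omega

end


/-! ### Lower bounds for the width -/

section
variable {K : Type*} [CommRing K] {a b : ℕ}

/-- If all proper divisors of a monomial have singleton fibers, while its own fiber is larger,
then its vertices embed in `[n]` whenever the `n`-th truncation generates `ker π`. -/
lemma exists_perm_of_span_truncation [Nontrivial K] {n : ℕ} {M M' : YIdx →₀ ℕ} (hne : M ≠ M')
    (hexp : expo a b M = expo a b M')
    (hM : ∀ e ≤ M, e ≠ M → ∀ e', expo a b e' = expo a b e → e' = e)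
    (hspan : Ideal.span (orbits (truncation n (toricIdeal K a b : Set (MvPolynomial YIdx K))))
      = toricIdeal K a b) :
    ∃ σ : Equiv.Perm ℕ, ∀ p, M p ≠ 0 → σ p.1.1 < n ∧ σ p.1.2 < n := by
  classical
  by_contra! hσ
  -- If no permutation moves the vertices of `M` into `[n]`, then `M` occurs in no element of the
  -- ideal, contradicting the binomial `M - M'`.
  have key (f) (hf : f ∈ toricIdeal K a b) : ∀ g, coeff M (g * f) = 0 := by
    rw [← hspan] at hf
    induction hf using Submodule.span_induction with
    | zero => simp
    | add f₁ f₂ _ _ h₁ h₂ => intro g; rw [mul_add, coeff_add, h₁, h₂, add_zero]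
    | smul c f _ h => intro g; rw [smul_eq_mul, ← mul_assoc, h]
    | mem f hf =>
      obtain ⟨σ, f, ⟨hf, hn⟩, rfl⟩ := hf
      intro g
      rw [coeff_mul]
      refine Finset.sum_eq_zero fun x hx => ?_
      rw [Finset.HasAntidiagonal.mem_antidiagonal] at hx
      have hle : x.2 ≤ M := hx ▸ le_add_self
      suffices h : coeff x.2 (rename (permPair σ) f) = 0 by rw [h, mul_zero]
      by_contra h
      -- A generator cannot contain `M` itself, as its variables come from `[n]` up to `σ`. Its
      -- coefficients at proper divisors of `M` vanish because their fibers are singletons.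
      rcases eq_or_ne x.2 M with hxM | hxM
      · obtain ⟨u, hu, hc⟩ := coeff_rename_ne_zero _ _ _ h
        obtain ⟨p, hp, hpn⟩ := hσ σ.symm
        rw [hxM] at hu
        rw [← hu] at hp
        obtain ⟨q, hq, rfl⟩ := Finset.mem_image.1
          (Finsupp.mapDomain_support (Finsupp.mem_support_iff.2 hp))
        have hqn := mem_supported.1 hn
          (show q ∈ (f.vars : Set YIdx) from (mem_vars_iff_mem_support q).2 ⟨u, mem_support_iff.2 hc, hq⟩)
        simp only [permPair, Equiv.symm_apply_apply] at hpn
        exact absurd (hpn hqn.1) (not_le.2 hqn.2)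
      · apply h
        rw [← coeff_toricMap_of_fiber (hM _ hle hxM),
          mem_toricIdeal.1 (rename_mem_toricIdeal σ hf), coeff_zero]
  have := key _ (monomial_sub_mem_toricIdeal.2 hexp) 1
  rw [one_mul, coeff_sub, coeff_monomial, coeff_monomial, if_pos rfl, if_neg hne.symm,
    sub_zero] at this
  exact one_ne_zero this

lemma card_le_of_perm_lt {n : ℕ} (σ : Equiv.Perm ℕ) (S : Finset ℕ) (h : ∀ v ∈ S, σ v < n) :
    S.card ≤ n := by
  simpa using Finset.card_le_card_of_injOn (t := Finset.range n) σ
    (fun v hv => by simpa using h v hv)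
    σ.injective.injOn

/-! ### Singleton fibers of multigraphs with a single sink -/

lemma eq_of_edges_into {c : ℕ} {e e' : YIdx →₀ ℕ} (he : ∀ i, i ≠ c → inDeg i e = 0)
    (he' : ∀ i, i ≠ c → inDeg i e' = 0) (h : ∀ i, outDeg i e = outDeg i e') : e = e' := by
  have zero {G : YIdx →₀ ℕ} (hG : ∀ i, i ≠ c → inDeg i G = 0) (p : YIdx) (hp : p.1.2 ≠ c) :
      G p = 0 := Nat.eq_zero_of_le_zero (hG _ hp ▸ le_count _ rfl)
  have out {G : YIdx →₀ ℕ} (hG : ∀ i, i ≠ c → inDeg i G = 0) (i : ℕ) (hi : i ≠ c) :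
      outDeg i G = G ⟨(i, c), hi⟩ := by
    rw [outDeg_eq_add hi, add_eq_left]
    refine count_eq_zero _ fun p hp h => ?_
    exact Finsupp.mem_support_iff.1 hp (zero hG p h.2)
  ext ⟨⟨i, j⟩, hij⟩
  by_cases hj : j = c
  · subst hj
    rw [← out he i hij, ← out he' i hij, h]
  · rw [zero he _ hj, zero he' _ hj]

lemma eq_of_expo_eq_of_edges_into (hb : 1 ≤ b) (hcop : Nat.Coprime a b) {c : ℕ}
    {e : YIdx →₀ ℕ} (he : ∀ i, i ≠ c → inDeg i e = 0) (hc : inDeg c e < a) (e' : YIdx →₀ ℕ)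
    (h : expo a b e' = expo a b e) : e' = e := by
  have hout := outDeg_eq_of_inDeg_lt hb hcop h.symm fun i => by
    rcases eq_or_ne i c with rfl | hi
    · exact hc
    · rw [he i hi]; omega
  refine (eq_of_edges_into he (fun i hi => ?_) hout).symm
  rw [← inDeg_eq_of_outDeg_eq hb h.symm (hout i), he i hi]

end


section
variable {K : Type*} [CommRing K] [Nontrivial K] {a b n : ℕ}

/-- The critical monomial is one side of the basic quadric. A proper divisor has at most one edge,
hence one sink of in-degree at most `1 < a`. -/
lemma four_le_of_span_truncation (hb : 1 ≤ b) (hab : b < a) (hcop : Nat.Coprime a b)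
    (hspan : Ideal.span (orbits (truncation n (toricIdeal K a b : Set (MvPolynomial YIdx K))))
      = toricIdeal K a b) : 4 ≤ n := by
  classical
  set M := edge 0 1 (by decide) + edge 2 3 (by decide) with hM
  have hM' : expo a b M = expo a b (edge 0 3 (by decide) + edge 2 1 (by decide)) := by
    rw [expo_eq_iff]
    intro i
    simp only [hM, map_add, count_single]
    ring
  have hMp (p : YIdx) : M p = (if p = ⟨(0, 1), by decide⟩ then 1 else 0)
      + (if p = ⟨(2, 3), by decide⟩ then 1 else 0) := by
    simp only [hM, Finsupp.add_apply, Finsupp.single_apply, eq_comm]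
  obtain ⟨σ, hσ⟩ := exists_perm_of_span_truncation (M := M) (fun h => by
    have := DFunLike.congr_fun h ⟨(0, 1), by decide⟩
    simp [hM] at this) hM' (fun e he hne => by
    have into (c : ℕ) (hc : inDeg c M = 1) (h : ∀ p : YIdx, p.1.2 ≠ c → e p = 0) (e' : YIdx →₀ ℕ)
        (he' : expo a b e' = expo a b e) : e' = e := by
      refine eq_of_expo_eq_of_edges_into (c := c) hb hcop (fun i hi => count_eq_zero _ ?_)
        (lt_of_le_of_lt (count_mono _ he) (by rw [hc]; omega)) e' he'
      rintro p hp rfl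
      exact Finsupp.mem_support_iff.1 hp (h p hi)
    by_cases h1 : e ⟨(0, 1), by decide⟩ = 0
    · refine into 3 (by simp [hM, count_single]) fun p hp => ?_
      by_cases hp' : p = ⟨(0, 1), by decide⟩
      · rw [hp', h1]
      · have := he p
        rw [hMp, if_neg hp', if_neg (by rintro rfl; exact hp rfl)] at this
        omega
    by_cases h2 : e ⟨(2, 3), by decide⟩ = 0
    · refine into 1 (by simp [hM, count_single]) fun p hp => ?_
      by_cases hp' : p = ⟨(2, 3), by decide⟩
      · rw [hp', h2]
      · have := he p
        rw [hMp, if_neg hp', if_neg (by rintro rfl; exact hp rfl)] at this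
        omega
    refine absurd (le_antisymm he fun p => ?_) hne
    rw [hMp]
    split_ifs with h3 h4 h4
    · rw [h3] at h4
      simp at h4
    · rw [h3]; omega
    · rw [h4]; omega
    · simp) hspan
  have h01 := hσ ⟨(0, 1), by decide⟩ (by simp [hMp])
  have h23 := hσ ⟨(2, 3), by decide⟩ (by simp [hMp])
  refine card_le_of_perm_lt σ {0, 1, 2, 3} fun v hv => ?_
  simp only [Finset.mem_insert, Finset.mem_singleton] at hv
  rcases hv with rfl | rfl | rfl | rfl
  exacts [h01.1, h01.2, h23.1, h23.2]

/-! ### The star binomial -/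

/-- The exponent vector with all its edges pointing to the vertex `1` that occurs in
`starLeft`. -/
noncomputable def starExp (a b : ℕ) : YIdx →₀ ℕ :=
  threeExp b 0 (∑ k ∈ Finset.range (a - b), Finsupp.single k 1) 0

lemma starLeft_eq (K : Type*) [CommRing K] (a b : ℕ) : starLeft K a b = monomial (starExp a b) 1 := by
  rw [starLeft, starExp, threeExp, y_pow_eq, Finsupp.mapDomain_finsetSum,
    Finsupp.mapDomain_zero, add_zero, add_zero, ← mul_one (1 : K), ← monomial_mul,
    monomial_sum_index]
  simp only [y_eq, Finsupp.mapDomain_single, C_1, one_mul, mul_one]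

lemma starRight_eq (K : Type*) [CommRing K] (a b : ℕ) :
    starRight K a b = monomial (swapped 0 1 (starExp a b)) 1 := by
  have h (k : ℕ) : Equiv.swap 0 1 (k + 2) = k + 2 :=
    Equiv.swap_apply_of_ne_of_ne (by omega) (by omega)
  rw [starRight, starExp, threeExp, y_pow_eq, Finsupp.mapDomain_finsetSum,
    Finsupp.mapDomain_zero, add_zero, add_zero, swapped, Finsupp.mapDomain_add,
    Finsupp.mapDomain_finsetSum, ← mul_one (1 : K), ← monomial_mul, monomial_sum_index]
  simp only [y_eq, Finsupp.mapDomain_single, C_1, one_mul, mul_one, permPair, h,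
    Equiv.swap_apply_left, Equiv.swap_apply_right]

lemma degree_starExp (hab : b < a) : (starExp a b).degree = a := by
  rw [starExp, degree_threeExp]
  simp [map_sum]
  omega

lemma snd_eq_one_of_starExp_ne_zero {p : YIdx} (hp : starExp a b p ≠ 0) : p.1.2 = 1 := by
  classical
  by_contra h
  apply hp
  rw [starExp, threeExp, Finsupp.mapDomain_zero, add_zero, Finsupp.add_apply,
    Finsupp.single_eq_of_ne (by rintro rfl; exact h rfl), zero_add]
  by_contra h'
  obtain ⟨k, -, rfl⟩ := Finset.mem_image.1
    (Finsupp.mapDomain_support (Finsupp.mem_support_iff.2 h'))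
  exact h rfl

lemma inDeg_starExp_one (hab : b < a) : inDeg 1 (starExp a b) = a := by
  rw [inDeg, count_eq_degree _ fun p hp => snd_eq_one_of_starExp_ne_zero (by simpa using hp),
    degree_starExp hab]

lemma inDeg_starExp_of_ne {i : ℕ} (hi : i ≠ 1) : inDeg i (starExp a b) = 0 :=
  count_eq_zero _ fun p hp h => hi (h.symm.trans (snd_eq_one_of_starExp_ne_zero (by simpa using hp)))

lemma outDeg_starExp_zero : outDeg 0 (starExp a b) = b := by
  simp [starExp, threeExp, Finsupp.mapDomain_finsetSum, Finsupp.mapDomain_single, map_sum,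
    count_single]

lemma outDeg_starExp_one : outDeg 1 (starExp a b) = 0 := by
  simp [starExp, threeExp, Finsupp.mapDomain_finsetSum, Finsupp.mapDomain_single, map_sum,
    count_single]

lemma outDeg_starExp_le {i : ℕ} (hi : i ≠ 0) : outDeg i (starExp a b) ≤ 1 := by
  simp only [starExp, threeExp, Finsupp.mapDomain_finsetSum, Finsupp.mapDomain_single, map_sum,
    count_single, map_add, Finsupp.mapDomain_zero, if_neg hi.symm, zero_add, add_zero]
  rw [← Finset.card_filter]
  refine Finset.card_le_one.2 fun k hk l hl => ?_
  have h1 := (Finset.mem_filter.1 hk).2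
  have h2 := (Finset.mem_filter.1 hl).2
  omega

lemma starExp_apply_pos {k : ℕ} (hk : k < a - b) : 0 < starExp a b ⟨(k + 2, 1), by simp⟩ := by
  have hinj : Function.Injective fun k : ℕ => (⟨(k + 2, 1), by simp⟩ : YIdx) :=
    fun k l h => by simpa using h
  rw [starExp, threeExp, Finsupp.add_apply, Finsupp.add_apply,
    Finsupp.mapDomain_apply hinj]
  simp [Finsupp.single_apply, hk, Finsupp.finsetSum_apply]

lemma expo_swapped_starExp (hab : b < a) :
    expo a b (swapped 0 1 (starExp a b)) = expo a b (starExp a b) :=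
  expo_swapped (expo_threeExp hab (Nat.zero_le _) (by simp [map_sum]) (by simp))

lemma starExp_ne_swapped (hb : 1 ≤ b) : starExp a b ≠ swapped 0 1 (starExp a b) :=
  ne_swapped_of_outDeg_ne (by rw [outDeg_starExp_zero, outDeg_starExp_one]; omega)

/-- The star has exactly `a` edges, all into vertex `1`. A proper divisor has in-degree below `a`
there, so its fiber is a singleton. -/
lemma sub_add_two_le_of_span_truncation (hb : 1 ≤ b) (hab : b < a) (hcop : Nat.Coprime a b)
    (hspan : Ideal.span (orbits (truncation n (toricIdeal K a b : Set (MvPolynomial YIdx K))))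
      = toricIdeal K a b) : a - b + 2 ≤ n := by
  obtain ⟨σ, hσ⟩ := exists_perm_of_span_truncation (starExp_ne_swapped hb)
    (expo_swapped_starExp hab).symm (fun e he hne => by
      obtain ⟨R, hR⟩ := exists_add_of_le he
      refine eq_of_expo_eq_of_edges_into (c := 1) hb hcop (fun i hi => ?_) ?_
      · exact Nat.eq_zero_of_le_zero (inDeg_starExp_of_ne (a := a) (b := b) hi ▸ count_mono _ he)
      · have h1 := degree_eq_avoid_add 1 e
        have h2 := congrArg Finsupp.degree hR
        rw [degree_starExp hab, map_add] at h2
        have h3 : R.degree ≠ 0 := by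
          rw [Ne, Finsupp.degree_eq_zero_iff]
          rintro rfl
          exact hne (by rw [hR, add_zero])
        omega) hspan
  have h01 := hσ ⟨(0, 1), by decide⟩ (by
    simp only [starExp, threeExp, Finsupp.add_apply, Finsupp.single_eq_same]
    omega)
  rw [← Finset.card_range (a - b + 2)]
  refine card_le_of_perm_lt σ _ fun v hv => ?_
  rw [Finset.mem_range] at hv
  match v, hv with
  | 0, _ => exact h01.1
  | 1, _ => exact h01.2
  | k + 2, hv => exact (hσ _ (starExp_apply_pos (a := a) (b := b) (k := k) (by omega)).ne').1

lemma degree_eq_inDeg_add (i : ℕ) (G : YIdx →₀ ℕ) :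
    G.degree = inDeg i G + count (fun p => p.1.2 ≠ i) G := by
  rw [← count_eq_degree (fun _ => True) fun _ _ => trivial]
  exact count_union _ _ _ (fun p => by tauto) (fun p h h' => h' h) G

lemma eq_or_eq_of_expo_eq_starExp (hb : 2 ≤ b) (hab : b < a) (hcop : Nat.Coprime a b)
    {m : YIdx →₀ ℕ} (h : expo a b m = expo a b (starExp a b)) :
    m = starExp a b ∨ m = swapped 0 1 (starExp a b) := by
  have hb1 : 1 ≤ b := by omega
  have hdeg := degree_eq_of_expo_eq (by omega) h
  by_cases hne : ∃ i, outDeg i m ≠ outDeg i (starExp a b)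
  · right
    obtain ⟨j, hj⟩ := exists_outDeg_lt hdeg hne
    obtain ⟨d, hd, ho, hi⟩ := le_sub_of_expo_eq hb1 hcop h.symm hj
    have hbd : b * 1 ≤ b * d := Nat.mul_le_mul_left b hd
    have had : a * 1 ≤ a * d := Nat.mul_le_mul_left a hd
    -- This is where `b ≥ 2` enters: a vertex can only lose a multiple of `b` of out-degree, and
    -- every vertex but `0` has out-degree at most `1`.
    obtain rfl : j = 0 := by
      by_contra hj0
      have := outDeg_starExp_le (a := a) (b := b) hj0
      omega
    rw [degree_starExp hab] at hdeg
    have hm := degree_eq_avoid_add 0 m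
    -- Vertex `0` gains in-degree at least `a`, which is the total number of edges, so all edges of
    -- `m` point to `0`.
    have hin0 : inDeg 0 m = a := by omega
    have hin (i) (hi : i ≠ 0) : inDeg i m = 0 := by
      refine count_eq_zero _ fun p hp hpi => ?_
      have h1 := degree_eq_inDeg_add 0 m
      have h2 : m p ≤ count (fun p => p.1.2 ≠ 0) m := le_count _ (by rw [hpi]; exact hi)
      have h3 := Finsupp.mem_support_iff.1 hp
      omega
    have hin' (i) : inDeg i (swapped 0 1 (starExp a b)) = inDeg i m := by
      rw [inDeg_swapped]
      rcases eq_or_ne i 0 with rfl | hi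
      · rw [Equiv.swap_apply_left, inDeg_starExp_one hab, hin0]
      · rw [hin i hi, inDeg_starExp_of_ne]
        rw [Ne, Equiv.swap_apply_eq_iff, Equiv.swap_apply_right]
        exact hi
    refine eq_of_edges_into hin (fun i hi => by rw [hin', hin i hi]) fun i => ?_
    have h1 := expo_eq_iff.1 (h.trans (expo_swapped_starExp hab).symm) i
    rw [hin'] at h1
    exact Nat.eq_of_mul_eq_mul_left (by omega) (Nat.add_right_cancel h1)
  · left
    push Not at hne
    refine eq_of_edges_into (c := 1) (fun i hi => ?_) (fun i hi => inDeg_starExp_of_ne hi) hne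
    rw [inDeg_eq_of_outDeg_eq hb1 h (hne i), inDeg_starExp_of_ne hi]

lemma toricMap_starLeft (K : Type*) [CommRing K] {a b : ℕ} (hab : b < a) : toricMap K a b (starLeft K a b)
    = X 0 ^ (a * b) * X 1 ^ (a * b) * ∏ k ∈ Finset.range (a - b), X (k + 2) ^ a := by
  have h : ((X 1 : MvPolynomial ℕ K) ^ b) ^ b * (X 1 ^ b) ^ (a - b) = X 1 ^ (a * b) := by
    rw [← pow_add, Nat.add_sub_cancel' hab.le, ← pow_mul, mul_comm b a]
  simp only [starLeft, toricMap, map_mul, map_pow, map_prod, y, aeval_X]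
  rw [Finset.prod_mul_distrib, Finset.prod_const, Finset.card_range, ← h]
  ring

lemma fiber_star (hb : 2 ≤ b) (hab : b < a) (hcop : Nat.Coprime a b) :
    starLeft K a b ≠ starRight K a b ∧
    fiber K a b (X 0 ^ (a * b) * X 1 ^ (a * b) * ∏ k ∈ Finset.range (a - b), X (k + 2) ^ a)
      = {starLeft K a b, starRight K a b} := by
  rw [← toricMap_starLeft K hab, starLeft_eq, starRight_eq]
  refine ⟨fun h => starExp_ne_swapped (a := a) (show 1 ≤ b by omega)
    (monomial_left_injective one_ne_zero h), Set.Subset.antisymm ?_ ?_⟩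
  · rintro _ ⟨⟨m, rfl⟩, hm⟩
    rw [toricMap_monomial, toricMap_monomial] at hm
    rcases eq_or_eq_of_expo_eq_starExp hb hab hcop (monomial_left_injective one_ne_zero hm)
      with rfl | rfl
    exacts [Or.inl rfl, Or.inr rfl]
  · rintro _ (rfl | rfl)
    · exact ⟨⟨_, rfl⟩, rfl⟩
    · exact ⟨⟨_, rfl⟩, by rw [toricMap_monomial, toricMap_monomial, expo_swapped_starExp hab]⟩

/-! ### Upper bounds for the width -/

lemma monomial_mem_supported {u : YIdx →₀ ℕ} {s : Set YIdx} (h : ∀ p, u p ≠ 0 → p ∈ s) :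
    monomial u (1 : K) ∈ supported K s := by
  rw [mem_supported, vars_monomial one_ne_zero]
  exact fun p hp => h p (by simpa using hp)

lemma swapped_apply (i j : ℕ) (G : YIdx →₀ ℕ) (p : YIdx) :
    swapped i j G p = G (permPair (Equiv.swap i j) p) := by
  have h : p = permPair (Equiv.swap i j) (permPair (Equiv.swap i j) p) := by
    simp [permPair]
  conv_lhs => rw [h]
  exact Finsupp.mapDomain_apply (permPair_injective _) _ _

lemma binomial_mem_supported {N : ℕ} (hN : 2 ≤ N) {u : YIdx →₀ ℕ}
    (h : ∀ p, u p ≠ 0 → p.1.1 < N ∧ p.1.2 < N) :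
    monomial u (1 : K) - monomial (swapped 0 1 u) 1
      ∈ supported K {p : YIdx | p.1.1 < N ∧ p.1.2 < N} := by
  refine sub_mem (monomial_mem_supported h) (monomial_mem_supported fun p hp => ?_)
  rw [swapped_apply] at hp
  have key (k : ℕ) (hk : Equiv.swap 0 1 k < N) : k < N := by
    by_contra hkN
    rw [Equiv.swap_apply_of_ne_of_ne (by omega) (by omega)] at hk
    exact hkN hk
  exact ⟨key _ (h _ hp).1, key _ (h _ hp).2⟩

lemma rename_familyThree (K : Type*) [CommRing K] (b n : ℕ) (ρ : Equiv.Perm ℕ) : ∃ τ : Equiv.Perm ℕ, ∀ (c₁ c₂ : ℕ →₀ ℕ),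
    rename (permPair τ) (familyThree K b n (c₁.mapDomain ρ) (c₂.mapDomain ρ))
      = familyThree K b n c₁ c₂ := by
  let ι : ℕ ↪ ℕ := ⟨fun k => k + 2, fun k l h => by simpa using h⟩
  have hι {k : ℕ} (hk : k < 2) : k ∉ Set.range ι := by
    rintro ⟨l, hl⟩
    have : l + 2 = k := hl
    omega
  -- `τ` fixes `0` and `1` and undoes `ρ` on the shifted labels `k + 2` of the other vertices.
  set τ := Equiv.Perm.viaEmbedding ρ.symm ι
  have h0 : τ 0 = 0 := Equiv.Perm.viaEmbedding_apply_of_notMem _ _ _ (hι (by omega))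
  have h1 : τ 1 = 1 := Equiv.Perm.viaEmbedding_apply_of_notMem _ _ _ (hι (by omega))
  have h2 (k : ℕ) : τ (ρ k + 2) = k + 2 :=
    (Equiv.Perm.viaEmbedding_apply (ρ.symm : Equiv.Perm ℕ) ι (ρ k)).trans
      (congrArg ι (ρ.symm_apply_apply k))
  refine ⟨τ, fun c₁ c₂ => ?_⟩
  have key : (threeExp b n (c₁.mapDomain ρ) (c₂.mapDomain ρ)).mapDomain (permPair τ)
      = threeExp b n c₁ c₂ := by
    simp only [threeExp, Finsupp.mapDomain_add, Finsupp.mapDomain_single,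
      ← Finsupp.mapDomain_comp, Function.comp_def, permPair, h0, h1, h2]
  rw [familyThree_eq, familyThree_eq, map_sub, rename_monomial, rename_monomial,
    mapDomain_swapped, key, h0, h1]

lemma exists_perm_lt_of_card_le {m : ℕ} (S : Finset ℕ) (hS : S.card ≤ m) :
    ∃ ρ : Equiv.Perm ℕ, ∀ k ∈ S, ρ k < m := by
  obtain ⟨ρ, hρ⟩ := exists_perm_apply_eq (n := S.card) (fun i => (S.equivFin.symm i : ℕ))
    (fun i => i) (Subtype.val_injective.comp S.equivFin.symm.injective) Fin.val_injective
  refine ⟨ρ, fun k hk => ?_⟩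
  have := hρ (S.equivFin ⟨k, hk⟩)
  simp only [Equiv.symm_apply_apply] at this
  rw [this]
  omega

lemma card_support_le_degree (c : ℕ →₀ ℕ) : c.support.card ≤ c.degree := by
  rw [Finset.card_eq_sum_ones, Finsupp.degree_apply]
  exact Finset.sum_le_sum fun k hk => Nat.one_le_iff_ne_zero.2 (Finsupp.mem_support_iff.1 hk)

lemma threeExp_vertices_lt {m : ℕ} {c₁ c₂ : ℕ →₀ ℕ} (h₁ : ∀ k, c₁ k ≠ 0 → k < m)
    (h₂ : ∀ k, c₂ k ≠ 0 → k < m) {p : YIdx} (hp : threeExp b n c₁ c₂ p ≠ 0) :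
    p.1.1 < m + 2 ∧ p.1.2 < m + 2 := by
  classical
  rw [threeExp, Finsupp.add_apply, Finsupp.add_apply] at hp
  by_cases hp0 : p = ⟨(0, 1), by decide⟩
  · rw [hp0]
    simp
  rw [Finsupp.single_eq_of_ne hp0, zero_add, Ne, Nat.add_eq_zero_iff, not_and_or] at hp
  rcases hp with hp | hp
  · obtain ⟨k, hk, rfl⟩ := Finset.mem_image.1
      (Finsupp.mapDomain_support (Finsupp.mem_support_iff.2 hp))
    have := h₁ k (Finsupp.mem_support_iff.1 hk)
    simpa
  · obtain ⟨k, hk, rfl⟩ := Finset.mem_image.1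
      (Finsupp.mapDomain_support (Finsupp.mem_support_iff.2 hp))
    have := h₂ k (Finsupp.mem_support_iff.1 hk)
    simpa

lemma fourExp_vertices_lt {p : YIdx} (hp : fourExp a b n p ≠ 0) : p.1.1 < 4 ∧ p.1.2 < 4 := by
  classical
  simp only [fourExp, Finsupp.add_apply, Finsupp.single_apply] at hp
  split_ifs at hp with h1 h2 h3 h3 h2 h3 h3
  all_goals first
    | (subst h1; simp)
    | (subst h2; simp)
    | (subst h3; simp)
    | simp at hp

/-- A binomial of type (iii) uses at most `(a - b - n) + n = a - b` vertices besides the two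
centers. They can be renumbered consecutively without leaving the family. The other types already
live on at most four vertices. -/
lemma markovFamily_subset_orbits_truncation :
    markovFamily K a b ⊆ orbits (truncation (max 4 (a - b + 2)) (markovFamily K a b)) := by
  classical
  have hN : 4 ≤ max 4 (a - b + 2) := le_max_left _ _
  have hN' : a - b + 2 ≤ max 4 (a - b + 2) := le_max_right _ _
  generalize max 4 (a - b + 2) = N at hN hN'
  have hX (i j : ℕ) (h : i ≠ j) (hi : i < 4) (hj : j < 4) :
      y K i j h ∈ supported K {p : YIdx | p.1.1 < N ∧ p.1.2 < N} :=
    X_mem_supported.2 ⟨by dsimp only; omega, by dsimp only; omega⟩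
  rintro f (rfl | rfl | ⟨n, c₁, c₂, hn, h₁, h₂, rfl⟩ | ⟨n, h1, hn, rfl⟩)
  · refine subset_orbits _ ⟨Or.inl rfl, sub_mem (mul_mem ?_ ?_) (mul_mem ?_ ?_)⟩ <;>
      exact hX _ _ _ (by decide) (by decide)
  · refine subset_orbits _ ⟨Or.inr (Or.inl rfl),
      sub_mem (mul_mem (mul_mem ?_ ?_) ?_) (mul_mem (mul_mem ?_ ?_) ?_)⟩ <;>
      exact hX _ _ _ (by decide) (by decide)
  · change c₁.degree = _ at h₁
    change c₂.degree = _ at h₂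
    obtain ⟨ρ, hρ⟩ := exists_perm_lt_of_card_le (m := a - b) (c₁.support ∪ c₂.support) (by
      have := Finset.card_union_le c₁.support c₂.support
      have := card_support_le_degree c₁
      have := card_support_le_degree c₂
      omega)
    obtain ⟨τ, hτ⟩ := rename_familyThree K b n ρ
    have hlt {c : ℕ →₀ ℕ} (hc : c.support ⊆ c₁.support ∪ c₂.support) (k : ℕ)
        (hk : c.mapDomain ρ k ≠ 0) : k < a - b := by
      obtain ⟨l, hl, rfl⟩ := Finset.mem_image.1
        (Finsupp.mapDomain_support (Finsupp.mem_support_iff.2 hk))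
      exact hρ l (hc hl)
    refine ⟨τ, _, ⟨Or.inr (Or.inr (Or.inl ⟨n, c₁.mapDomain ρ, c₂.mapDomain ρ, hn,
      (Finsupp.degree_mapDomain ρ c₁).trans h₁, (Finsupp.degree_mapDomain ρ c₂).trans h₂,
      rfl⟩)), ?_⟩, (hτ c₁ c₂).symm⟩
    rw [familyThree_eq]
    refine binomial_mem_supported (by omega) fun p hp => ?_
    have := threeExp_vertices_lt (hlt Finset.subset_union_left) (hlt Finset.subset_union_right) hp
    omega
  · refine subset_orbits _ ⟨Or.inr (Or.inr (Or.inr ⟨n, h1, hn, rfl⟩)), ?_⟩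
    rw [familyFour_eq]
    refine binomial_mem_supported (by omega) fun p hp => ?_
    have := fourExp_vertices_lt hp
    omega

/-! ### The widths of the ideal and of its equivariant Markov bases -/

lemma span_truncation_toricIdeal {K : Type*} [CommRing K] {M : Set (MvPolynomial YIdx K)}
    (hM : IsEquivariantMarkovBasis a b M) (h : M ⊆ orbits (truncation n M)) :
    Ideal.span (orbits (truncation n (toricIdeal K a b : Set (MvPolynomial YIdx K))))
      = toricIdeal K a b := by
  refine le_antisymm (span_orbits_le fun f hf => hf.1) ?_
  have hMI : M ⊆ toricIdeal K a b := fun f hf => by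
    rw [← hM]
    exact Ideal.subset_span (subset_orbits M hf)
  conv_lhs => rw [← hM]
  exact Ideal.span_mono ((orbits_mono h).trans ((orbits_orbits _).trans
    (orbits_mono fun f hf => ⟨hMI hf.1, hf.2⟩)))

lemma max_le_of_span_truncation (hb : 1 ≤ b) (hab : b < a) (hcop : Nat.Coprime a b)
    (hspan : Ideal.span (orbits (truncation n (toricIdeal K a b : Set (MvPolynomial YIdx K))))
      = toricIdeal K a b) : max 4 (a - b + 2) ≤ n :=
  max_le (four_le_of_span_truncation hb hab hcop hspan)
    (sub_add_two_le_of_span_truncation hb hab hcop hspan)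

lemma le_setWidth (hb : 1 ≤ b) (hab : b < a) (hcop : Nat.Coprime a b)
    {M : Set (MvPolynomial YIdx K)} (hM : IsEquivariantMarkovBasis a b M) :
    ((max 4 (a - b + 2) : ℕ) : ℕ∞) ≤ setWidth M := by
  refine le_sInf ?_
  rintro _ ⟨n, hn, rfl⟩
  exact Nat.cast_le.2 (max_le_of_span_truncation hb hab hcop (span_truncation_toricIdeal hM hn))

lemma idealWidth_toricIdeal (hb : 1 ≤ b) (hab : b < a) (hcop : Nat.Coprime a b) :
    idealWidth (toricIdeal K a b) = ((max 4 (a - b + 2) : ℕ) : ℕ∞) := by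
  refine le_antisymm (sInf_le ⟨_, span_truncation_toricIdeal
    (isEquivariantMarkovBasis_markovFamily hb hab hcop)
    markovFamily_subset_orbits_truncation, rfl⟩) (le_sInf ?_)
  rintro _ ⟨n, hn, rfl⟩
  exact Nat.cast_le.2 (max_le_of_span_truncation hb hab hcop hn)

lemma setWidth_markovFamily (hb : 1 ≤ b) (hab : b < a) (hcop : Nat.Coprime a b) :
    setWidth (markovFamily K a b) = ((max 4 (a - b + 2) : ℕ) : ℕ∞) :=
  le_antisymm (sInf_le ⟨_, markovFamily_subset_orbits_truncation, rfl⟩)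
    (le_setWidth hb hab hcop (isEquivariantMarkovBasis_markovFamily hb hab hcop))

end

end EquivariantMarkov

theorem mainTheorem1 (K : Type*) [CommRing K] [Nontrivial K] (a b : ℕ)
    (hb : 1 ≤ b) (hab : b < a) (hcop : Nat.Coprime a b) :
    EquivariantMarkov.IsEquivariantMarkovBasis a b (EquivariantMarkov.markovFamily K a b) ∧
    IsGreatest (MvPolynomial.totalDegree '' EquivariantMarkov.markovFamily K a b)
      (max (a + b) (2 * a - b)) ∧
    EquivariantMarkov.idealWidth (EquivariantMarkov.toricIdeal K a b)
      = ((max 4 (a - b + 2) : ℕ) : ℕ∞) ∧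
    EquivariantMarkov.setWidth (EquivariantMarkov.markovFamily K a b)
      = ((max 4 (a - b + 2) : ℕ) : ℕ∞) ∧
    IsLeast {w : ℕ∞ | ∃ M : Set (MvPolynomial EquivariantMarkov.YIdx K),
        EquivariantMarkov.IsEquivariantMarkovBasis a b M ∧ w = EquivariantMarkov.setWidth M}
      ((max 4 (a - b + 2) : ℕ) : ℕ∞) ∧
    (2 ≤ b →
      EquivariantMarkov.starLeft K a b ≠ EquivariantMarkov.starRight K a b ∧
      EquivariantMarkov.fiber K a b
          (MvPolynomial.X 0 ^ (a * b) * MvPolynomial.X 1 ^ (a * b)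
            * ∏ k ∈ Finset.range (a - b), MvPolynomial.X (k + 2) ^ a)
        = {EquivariantMarkov.starLeft K a b, EquivariantMarkov.starRight K a b}) := by
  exact ⟨EquivariantMarkov.isEquivariantMarkovBasis_markovFamily hb hab hcop,
    EquivariantMarkov.isGreatest_totalDegree_markovFamily hb hab,
    EquivariantMarkov.idealWidth_toricIdeal hb hab hcop,
    EquivariantMarkov.setWidth_markovFamily hb hab hcop,
    ⟨⟨_, EquivariantMarkov.isEquivariantMarkovBasis_markovFamily hb hab hcop,
      (EquivariantMarkov.setWidth_markovFamily hb hab hcop).symm⟩,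
      fun _ ⟨_, hM, hw⟩ => hw ▸ EquivariantMarkov.le_setWidth hb hab hcop hM⟩,
    fun hb2 => EquivariantMarkov.fiber_star hb2 hab hcop⟩
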